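/- Let $Y$ be an $n$-dimensional toric Fano manifold with fan $\Sigma$ in $N_{\mathbb R}$, $N\cong\mathbb Z^n$, $M=\operatorname{Hom}(N,\mathbb Z)$; let $v_1,\dots,v_R\in N$ be the primitive ray generators and $D_1,\dots,D_R\in\operatorname{Pic}(Y)$ the classes of the corresponding toric divisors. Let $L_1,\dots,L_c\in\operatorname{Pic}(Y)$ be nef line bundles such that $-K_Y-L_1-\dots-L_c$ is ample. A *nef partition* of $(Y;L_1,\dots,L_c)$ is a partition of $\{1,\dots,R\}$ into sets $S_1,\dots,S_{c+1}$ with $L_i=\sum_{j\in S_i}D_j$ for $1\le i\le c$. An *amenable collection* subordinate to it is a family $u_1,\dots,u_c\in M$ such that for all $1\le i\le c$: $\langle u_i,v_k\rangle=-1$ for $k\in S_i$; $\langle u_i,v_k\rangle\ge 0$ for $k\in S_j$, $i<j\le c+1$; and $\langle u_i,v_k\rangle=0$ for $k\in S_j$, $1\le j<i$. Given such data and elements $s_i\in S_i$ $(1\le i\le c)$, put $W=\sum_{j=1}^R z^{v_j}$ and $G_i=\sum_{j\in S_i}z^{v_j}$ in $\mathbb C[N]$, and define inductively Laurent polynomials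 $F_i\in\mathbb C[u_i^\perp]\subset\mathbb C[N]$ and automorphisms $\mu_i^\star$ of the field $\mathbb C(N)=\operatorname{Frac}\mathbb C[N]$ by $$z^{v_{s_i}}F_i=\mu_{i-1}^\star\cdots\mu_1^\star G_i,\qquad \mu_i^\star(z^v)=z^vF_i^{\langle u_i,v\rangle}\quad(v\in N).$$ The *Laurent polynomial mirror* $f$ attached to $(S_\bullet,u_\bullet,s_\bullet)$ is the restriction of $\mu_c^\star\cdots\mu_1^\star W$ to the subtorus $\{z^{v_{s_1}}=\dots=z^{v_{s_c}}=1\}$, written in coordinates $y_1,\dots,y_{n-c}$ given by any isomorphism of this subtorus with $(\mathbb C^\star)^{n-c}$ (that is, by any isomorphism $N/\langle v_{s_1},\dots,v_{s_c}\rangle\cong\mathbb Z^{n-c}$). Two Laurent polynomials $f,g$ in $m$ variables are *mutation equivalent* if there is a birational map $\varphi\colon(\mathbb C^\star)^m\dashrightarrow(\mathbb C^\star)^m$ with $\varphi^\star f=g$ which is volume preserving, i.e. $\varphi^\star\omega_m=\pm\omega_m$ for $\omega_m=\bigwedge_{i=1}^m d\log y_i$ (a form which itself depends on the choice of coordinates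 of the torus up to sign). Then this construction is always well defined: for every nef partition of $(Y;L_1,\dots,L_c)$, every amenable collection subordinate to it and every choice of $s_i\in S_i$ one has $c\le n$ and a Laurent polynomial mirror $f\in\mathbb C[y_1^{\pm1},\dots,y_{n-c}^{\pm1}]$ exists. Moreover, any two Laurent polynomial mirrors obtained in this way, possibly from different nef partitions of $(Y;L_1,\dots,L_c)$, different amenable collections, and different choices of the $s_i$, are mutation equivalent. -/

import Mathlib

noncomputable section

namespace ToricLG

/-! ### Smooth complete fans, i.e. smooth complete toric varieties -/

/-- The lattice `N` of one-parameter subgroups. -/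
abbrev Latt (n : ℕ) := Fin n → ℤ

/-- The dual lattice `M = Hom(N, ℤ)`. -/
abbrev DualLatt (n : ℕ) := Module.Dual ℤ (Latt n)

/-- The cone in `N ⊗ ℝ` generated by the vectors `v i`, `i ∈ σ`. -/
def realCone {n : ℕ} {ι : Type*} (v : ι → Latt n) (σ : Finset ι) : Set (Fin n → ℝ) :=
  {x | ∃ a : ι → ℝ, (∀ i, 0 ≤ a i) ∧ x = ∑ i ∈ σ, a i • (fun k => (v i k : ℝ))}

/-- A smooth complete fan in `N = ℤⁿ` whose rays are indexed by `ι`. All cones of a smooth fan are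
simplicial, so a cone is recorded by the set of (indices of) its rays. Such a fan is the same thing
as a smooth complete toric variety `Y` of dimension `n`. -/
structure SmoothCompleteFan (n : ℕ) (ι : Type*) [DecidableEq ι] where
  /-- the primitive generators of the rays -/
  ray : ι → Latt n
  /-- the cones of the fan -/
  cones : Set (Finset ι)
  ray_injective : Function.Injective ray
  zero_mem : ∅ ∈ cones
  ray_mem : ∀ i, {i} ∈ cones
  face_mem : ∀ σ ∈ cones, ∀ τ ⊆ σ, τ ∈ cones
  inter_eq : ∀ σ ∈ cones, ∀ τ ∈ cones, realCone ray σ ∩ realCone ray τ = realCone ray (σ ∩ τ)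
  /-- the generators of every cone are part of a `ℤ`-basis of `N` -/
  smooth : ∀ σ ∈ cones, ∃ b : Module.Basis (Fin n) ℤ (Latt n), ∀ i ∈ σ, ray i ∈ Set.range b
  complete : ∀ x : Fin n → ℝ, ∃ σ ∈ cones, x ∈ realCone ray σ

namespace SmoothCompleteFan

variable {n : ℕ} {ι : Type*} [DecidableEq ι]

/-- The map `ρ* : M → (ℤ^R)*`, `m ↦ (⟨m, v_i⟩)_i`; its image consists of the principal
torus-invariant divisors. -/
def rhoStar (Y : SmoothCompleteFan n ι) : DualLatt n →ₗ[ℤ] (ι → ℤ) :=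
  LinearMap.pi fun i => Module.Dual.eval ℤ (Latt n) (Y.ray i)

/-- The Picard group of `Y`: torus-invariant divisors modulo linear equivalence. -/
abbrev Pic (Y : SmoothCompleteFan n ι) : Type _ := (ι → ℤ) ⧸ LinearMap.range Y.rhoStar

/-- The class of the divisor `∑ a_i D_i`. -/
def cls (Y : SmoothCompleteFan n ι) (a : ι → ℤ) : Y.Pic := Submodule.Quotient.mk a

/-- The class `D_i` of the toric prime divisor of the ray `i`. -/
def D (Y : SmoothCompleteFan n ι) (i : ι) : Y.Pic := Y.cls (Pi.single i 1)

/-- A line bundle is nef iff it is represented by a divisor `∑ a_i D_i` with convex support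
function. -/
def IsNef (Y : SmoothCompleteFan n ι) (L : Y.Pic) : Prop :=
  ∃ a : ι → ℤ, Y.cls a = L ∧ ∀ σ, Maximal (· ∈ Y.cones) σ →
    ∃ m : DualLatt n, (∀ i ∈ σ, m (Y.ray i) = -a i) ∧ ∀ j, j ∉ σ → -a j ≤ m (Y.ray j)

/-- A line bundle is ample iff it is represented by a divisor `∑ a_i D_i` with strictly convex
support function. -/
def IsAmple (Y : SmoothCompleteFan n ι) (L : Y.Pic) : Prop :=
  ∃ a : ι → ℤ, Y.cls a = L ∧ ∀ σ, Maximal (· ∈ Y.cones) σ →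
    ∃ m : DualLatt n, (∀ i ∈ σ, m (Y.ray i) = -a i) ∧ ∀ j, j ∉ σ → -a j < m (Y.ray j)

/-- The anticanonical class `-K_Y = ∑ D_i`. -/
def antiK [Fintype ι] (Y : SmoothCompleteFan n ι) : Y.Pic := ∑ i, Y.D i

/-- `Y` is Fano. -/
def IsFano [Fintype ι] (Y : SmoothCompleteFan n ι) : Prop := Y.IsAmple Y.antiK

end SmoothCompleteFan

/-! ### Nef partitions and amenable collections -/

/-- A nef partition of `(Y; L_1, …, L_c)`: a partition of the rays into sets `S_1, …, S_{c+1}`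
(here indexed from `0` to `c`) with `L_i = ∑_{j ∈ S_i} D_j` for the first `c` indices `i`. -/
structure NefPartition {n c : ℕ} {ι : Type*} [DecidableEq ι] [Fintype ι]
    (Y : SmoothCompleteFan n ι) (L : Fin c → Y.Pic) where
  /-- the index of the part that contains a given ray -/
  part : ι → Fin (c + 1)
  sum_eq : ∀ i : Fin c, ∑ j with part j = i.castSucc, Y.D j = L i

namespace NefPartition

variable {n c : ℕ} {ι : Type*} [DecidableEq ι] [Fintype ι]
  {Y : SmoothCompleteFan n ι} {L : Fin c → Y.Pic}

/-- The part `S_i`. -/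
def S (P : NefPartition Y L) (i : Fin (c + 1)) : Finset ι := {j | P.part j = i}

/-- Amenable collections of vectors in `M` subordinate to a nef partition. -/
structure IsAmenable (P : NefPartition Y L) (u : Fin c → DualLatt n) : Prop where
  neg_one : ∀ i : Fin c, ∀ k ∈ P.S i.castSucc, u i (Y.ray k) = -1
  nonneg : ∀ (i : Fin c) (j : Fin (c + 1)), i.castSucc < j → ∀ k ∈ P.S j, 0 ≤ u i (Y.ray k)
  zero : ∀ (i : Fin c) (j : Fin (c + 1)), j < i.castSucc → ∀ k ∈ P.S j, u i (Y.ray k) = 0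

end NefPartition

/-! ### Laurent polynomials, birational maps of tori, mutations -/

/-- The ring `ℂ[N]` of Laurent polynomials, the coordinate ring of an `n`-dimensional torus. -/
abbrev Laurent (n : ℕ) := AddMonoidAlgebra ℂ (Latt n)

/-- The field of rational functions of an `n`-dimensional torus. -/
abbrev FunField (n : ℕ) := FractionRing (Laurent n)

/-- The monomial `z^v`. -/
def mono {n : ℕ} (v : Latt n) : Laurent n := AddMonoidAlgebra.single v 1

/-- A Laurent polynomial as a rational function. -/
abbrev toFun {n : ℕ} (f : Laurent n) : FunField n := algebraMap (Laurent n) (FunField n) f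

/-- The pull-back of rational functions along birational self-maps of the torus: these are the
`ℂ`-automorphisms of the function field. -/
abbrev BirMap (n : ℕ) := FunField n ≃ₐ[ℂ] FunField n

/-- `μ` is (the pull-back along) the algebraic mutation with weight vector `w` and factor
`F ∈ ℂ[w^⊥]`, that is `z^v ↦ z^v F^{-⟨w,v⟩}`. -/
structure IsMutation {n : ℕ} (w : DualLatt n) (F : Laurent n) (μ : BirMap n) : Prop where
  factor_ne_zero : F ≠ 0
  factor_mem : ∀ v ∈ F.coeff.support, w v = 0
  map_mono : ∀ v : Latt n, μ (toFun (mono v)) = toFun (mono v) * toFun F ^ (-(w v))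

/-- The pull-backs `f ↦ μ_j (… (μ_1 f))` along the first `j` members of a finite sequence of
birational maps. -/
def iterPull {n c : ℕ} (μ : Fin c → BirMap n) (j : Fin (c + 1)) : BirMap n :=
  Fin.induction (motive := fun _ => BirMap n) AlgEquiv.refl (fun i e => e.trans (μ i)) j

/-- The form `d log x_1 ∧ ⋯ ∧ d log x_m`, a Kähler differential of top degree. -/
def dlogForm {m : ℕ} (x : Fin m → FunField m) :
    ⋀[FunField m]^m (Ω[FunField m⁄ℂ]) :=
  exteriorPower.ιMulti (FunField m) m
    fun i => (x i)⁻¹ • KaehlerDifferential.D ℂ (FunField m) (x i)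

/-- The coordinate functions on the torus. -/
def coord (m : ℕ) (i : Fin m) : FunField m := toFun (mono (Pi.single i 1))

/-- `φ` preserves the form `ω_m = d log y_1 ∧ ⋯ ∧ d log y_m`; this form depends on the choice of
coordinates of the torus up to sign, and is accordingly preserved up to sign. Note that
`φ^* ω_m = d log φ^*(y_1) ∧ ⋯ ∧ d log φ^*(y_m)`. -/
def IsVolumePreserving {m : ℕ} (φ : BirMap m) : Prop :=
  dlogForm (fun i => φ (coord m i)) = dlogForm (coord m) ∨
    dlogForm (fun i => φ (coord m i)) = -dlogForm (coord m)

/-- Mutation equivalence of Laurent polynomials. -/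
def MutationEquivalent {m : ℕ} (f g : Laurent m) : Prop :=
  ∃ φ : BirMap m, IsVolumePreserving φ ∧ φ (toFun f) = toFun g

/-! ### Laurent polynomial mirrors -/

section mirror

variable {n c : ℕ} {ι : Type*} [DecidableEq ι] [Fintype ι]
  {Y : SmoothCompleteFan n ι} {L : Fin c → Y.Pic}

/-- The superpotential `W`, the sum of all `z^{v_j}`. -/
def superpotential (Y : SmoothCompleteFan n ι) : Laurent n := ∑ j, mono (Y.ray j)

/-- The polynomial `G_i = ∑_{j ∈ S_i} z^{v_j}`. -/
def NefPartition.G (P : NefPartition Y L) (i : Fin (c + 1)) : Laurent n :=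
  ∑ j ∈ P.S i, mono (Y.ray j)

/-- `f` is the Laurent polynomial mirror obtained from the nef partition `P`, the amenable
collection `u` and the distinguished rays `s_i ∈ S_i`.

The mutations `μ_i` have weight `-u_i`, i.e. `z^v ↦ z^v F_i^{⟨u_i,v⟩}`, and their factors satisfy
`z^{v_{s_i}} F_i = μ_{i-1} (⋯ (μ_1 G_i))`. The pull-back `H` of `W` along all of them is restricted
to the subtorus `{z^{v_{s_1}} = ⋯ = z^{v_{s_c}} = 1}`. The homomorphism `q : N → ℤ^{n-c}`, which
is onto with kernel generated by the `v_{s_i}`, is a choice of coordinates on that subtorus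
(the restriction of `z^v` to it is `y^{q(v)}`). -/
def IsLaurentMirror (P : NefPartition Y L) (u : Fin c → DualLatt n) (s : Fin c → ι)
    (f : Laurent (n - c)) : Prop :=
  ∃ (F : Fin c → Laurent n) (μ : Fin c → BirMap n) (H : Laurent n) (q : Latt n →+ Latt (n - c)),
    (∀ i, IsMutation (-u i) (F i) (μ i)) ∧
    (∀ i, toFun (mono (Y.ray (s i)) * F i) = iterPull μ i.castSucc (toFun (P.G i.castSucc))) ∧
    toFun H = iterPull μ (Fin.last c) (toFun (superpotential Y)) ∧
    Function.Surjective q ∧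
    q.ker = AddSubgroup.closure (Set.range fun i => Y.ray (s i)) ∧
    f = AddMonoidAlgebra.mapDomain q H

end mirror

end ToricLG

end

/-! Every mirror is the superpotential `W` seen in a torus chart of the complete intersection `Z =
{G_1 = ⋯ = G_c = 1}`. Amenability makes the matrix `⟨u_i, v_{s_j}⟩` triangular with diagonal `-1`,
so `N` splits as `⋂ u_i^⊥` plus the span of the `v_{s_j}`. On `Z` the remaining coordinates are
forced one after another to be values of the factors `F_i`. Hence `Z` is birational to the torus of
`⋂ u_i^⊥`, and the mirror is `W` on `Z` (`apply_eq_mul_prod_eval_factor`, `eval_mirror`,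
`exists_generic_point`). For one nef partition this already disposes of the choices of `u` and `s`.

For two nef partitions, linear equivalence of the parts gives `M_a` in `M` with `⟨M_a, v_j⟩ = [j ∈
S_a] - [j ∈ S'_a]`. Twist a point `p'` of the second locus to `p(w) = p'(w) ∏ B_a^{-⟨M_a, w⟩}`. Then
`G_a(p) = G'_a(p')` for all `a` precisely when `B` is killed by the Laplacian of the digraph on the
parts with an edge `part j → part' j` of weight `p'(v_j)` for every ray; summing over `a`, including
the last part, also gives `W(p) = W(p')`. A positive relation among the rays makes the digraph a
union of strongly connected components, so at positive real weights the maximum principle shows that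
the Laplacian with one root per component removed is invertible. Evaluation at the unit of the
torus, where all weights are positive, transfers this to rational functions
(`exists_isUnit_det_lapMat`). The construction is undone by the reversed digraph, so it is
birational (`mem_of_twist_mem`).

For the volume form, the logarithmic Jacobian of the twist has determinant `±1` (`det_jacMat`) and
carries the gradient of each `G_a` to that of `G'_a` (`jacMat_mulVec_gvec`). In each chart the
gradients together with the chart directions form a frame whose determinant is a sign, as for a
Poincaré residue along `Z`; comparing the frames gives Jacobian `±1` on the charts
(`isVolumePreserving_of_jacobian`). -/

noncomputable section

namespace ToricLG

open Finset

/-! ### Characters of lattices and evaluation of Laurent polynomials -/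

/-- `p` is a character of the additive group `G`; for `G = N` this is a `K`-point of the torus with
character lattice `N`. -/
structure IsChar {G K : Type*} [AddCommGroup G] [Field K] (p : G → K) : Prop where
  map_zero : p 0 = 1
  map_add : ∀ v w, p (v + w) = p v * p w

namespace IsChar

variable {G K : Type*} [AddCommGroup G] [Field K] {p : G → K}

theorem ne_zero (hp : IsChar p) (v : G) : p v ≠ 0 := by
  intro h
  have := hp.map_add v (-v)
  rw [add_neg_cancel, hp.map_zero, h, zero_mul] at this
  exact one_ne_zero this

theorem map_neg (hp : IsChar p) (v : G) : p (-v) = (p v)⁻¹ := by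
  have := hp.map_add v (-v)
  rw [add_neg_cancel, hp.map_zero] at this
  exact eq_inv_of_mul_eq_one_right this.symm

/-- A character as a monoid homomorphism. -/
def toMonoidHom (hp : IsChar p) : Multiplicative G →* K where
  toFun v := p v.toAdd
  map_one' := hp.map_zero
  map_mul' _ _ := hp.map_add _ _

theorem map_zsmul (hp : IsChar p) (k : ℤ) (v : G) : p (k • v) = p v ^ k := by
  have h : ∀ k : ℕ, p ((k : ℤ) • v) = p v ^ k := by
    intro k
    induction k with
    | zero => simp [hp.map_zero]
    | succ k ih => rw [Nat.cast_succ, add_smul, one_smul, hp.map_add, ih, pow_succ]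
  obtain ⟨k, rfl | rfl⟩ := k.eq_nat_or_neg
  · rw [h, zpow_natCast]
  · rw [neg_smul, hp.map_neg, h, zpow_neg, zpow_natCast]

theorem map_sum (hp : IsChar p) {κ : Type*} (s : Finset κ) (x : κ → G) :
    p (∑ i ∈ s, x i) = ∏ i ∈ s, p (x i) := by
  classical
  induction s using Finset.induction_on with
  | empty => simp [hp.map_zero]
  | insert a s ha ih => rw [sum_insert ha, prod_insert ha, hp.map_add, ih]

theorem comp {G' : Type*} [AddCommGroup G'] (hp : IsChar p) (q : G' →+ G) :
    IsChar fun v => p (q v) :=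
  ⟨by rw [_root_.map_zero, hp.map_zero], fun v w => by rw [_root_.map_add, hp.map_add]⟩

/-- Twisting a character by powers of nonzero elements. -/
theorem mul_prod_zpow {κ : Type*} [Fintype κ] (hp : IsChar p) (b : κ → K)
    (hb : ∀ i, b i ≠ 0) (e : κ → G →+ ℤ) : IsChar fun v => p v * ∏ i, b i ^ e i v := by
  constructor
  · simp [hp.map_zero]
  · intro v w
    simp only [hp.map_add, _root_.map_add, zpow_add₀ (hb _), prod_mul_distrib]
    ring

variable {n : ℕ} {p : Latt n → K}

theorem apply_eq_prod (hp : IsChar p) (v : Latt n) :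
    p v = ∏ i, p (Pi.single i 1) ^ v i := by
  conv_lhs => rw [← Finset.univ_sum_single v]
  rw [hp.map_sum]
  refine prod_congr rfl fun i _ => ?_
  rw [← hp.map_zsmul, ← Pi.single_smul, smul_eq_mul, mul_one]

variable [Algebra ℂ K]

/-- Evaluation of Laurent polynomials at a point of the torus. -/
def eval (hp : IsChar p) : Laurent n →ₐ[ℂ] K :=
  AddMonoidAlgebra.lift ℂ K (Latt n) hp.toMonoidHom

@[simp] theorem eval_mono (hp : IsChar p) (v : Latt n) : hp.eval (mono v) = p v := by
  simp [eval, mono, toMonoidHom]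

end IsChar

theorem mono_zero {n : ℕ} : mono (0 : Latt n) = 1 := rfl

theorem mono_add {n : ℕ} (v w : Latt n) : mono (v + w) = mono v * mono w := by
  simp [mono, AddMonoidAlgebra.single_mul_single]

theorem mono_neg_mul {n : ℕ} (v : Latt n) (f : Laurent n) : mono v * (mono (-v) * f) = f := by
  rw [← mul_assoc, ← mono_add, add_neg_cancel, mono_zero, one_mul]

theorem mono_injective_mul {n : ℕ} {v : Latt n} {f g : Laurent n} (h : mono v * f = mono v * g) :
    f = g := by
  have := congrArg (mono (-v) * ·) h
  simpa only [← mul_assoc, ← mono_add, neg_add_cancel, mono_zero, one_mul] using this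

theorem algHom_ext_mono {n : ℕ} {A : Type*} [Semiring A] [Algebra ℂ A] {f g : Laurent n →ₐ[ℂ] A}
    (h : ∀ v, f (mono v) = g (mono v)) : f = g :=
  AddMonoidAlgebra.algHom_ext h (by ext)

theorem eq_sum_smul_mono {n : ℕ} (f : Laurent n) : f = ∑ v ∈ f.coeff.support, f.coeff v • mono v := by
  conv_lhs => rw [← AddMonoidAlgebra.sum_coeff_single f]
  simp [Finsupp.sum, mono]

theorem IsChar.eval_mem {n : ℕ} {K : Type*} [Field K] [Algebra ℂ K] {p : Latt n → K}
    (hp : IsChar p) {E : IntermediateField ℂ K} {f : Laurent n}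
    (h : ∀ v ∈ f.coeff.support, p v ∈ E) : hp.eval f ∈ E := by
  rw [eq_sum_smul_mono f, _root_.map_sum]
  refine sum_mem fun v hv => ?_
  rw [map_smul, hp.eval_mono]
  exact IntermediateField.smul_mem _ (h v hv)

/-- The tautological point of the torus. -/
theorem isChar_toFun_mono (n : ℕ) : IsChar fun v : Latt n => toFun (mono v) :=
  ⟨by rw [mono_zero, toFun, map_one], fun v w => by rw [mono_add, toFun, map_mul]⟩

theorem toFun_injective {n : ℕ} : Function.Injective (toFun : Laurent n → FunField n) :=
  IsFractionRing.injective _ _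

/-! ### Birational maps from generating characters -/

section auto

variable {m : ℕ}

/-- The inclusion of nonnegative exponents. -/
def expHom (m : ℕ) : (Fin m →₀ ℕ) →+ Latt m where
  toFun s i := s i
  map_zero' := by ext; simp
  map_add' s t := by ext; simp

theorem expHom_injective : Function.Injective (expHom m) := fun s t h => by
  ext i
  exact Nat.cast_injective (R := ℤ) (congrFun h i)

/-- The inclusion of polynomials into Laurent polynomials. -/
def polyIncl (m : ℕ) : MvPolynomial (Fin m) ℂ →ₐ[ℂ] Laurent m :=
  AddMonoidAlgebra.mapDomainAlgHom ℂ ℂ (expHom m)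

theorem polyIncl_injective : Function.Injective (polyIncl m) :=
  AddMonoidAlgebra.mapDomain_injective expHom_injective

theorem polyIncl_X (i : Fin m) : polyIncl m (MvPolynomial.X i) = mono (Pi.single i 1) := by
  have h : expHom m (Finsupp.single i 1) = Pi.single i 1 := by
    ext j
    simp [expHom, Finsupp.single_apply, Pi.single_apply, eq_comm]
  rw [← h]
  exact AddMonoidAlgebra.mapDomain_single

/-- Allowing all sufficiently large exponents lets two summands be cleared by one common monomial.
-/
theorem exists_mono_mul_eq_polyIncl (f : Laurent m) :
    ∃ k : ℕ, ∀ k' ≥ k, ∃ g, mono (fun _ => (k' : ℤ)) * f = polyIncl m g := by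
  induction f using AddMonoidAlgebra.induction_linear with
  | zero => exact ⟨0, fun _ _ => ⟨0, by simp⟩⟩
  | add f g hf hg =>
    obtain ⟨k, hk⟩ := hf
    obtain ⟨l, hl⟩ := hg
    refine ⟨max k l, fun k' hk' => ?_⟩
    obtain ⟨a, ha⟩ := hk k' (le_trans (le_max_left _ _) hk')
    obtain ⟨b, hb⟩ := hl k' (le_trans (le_max_right _ _) hk')
    exact ⟨a + b, by rw [mul_add, ha, hb, map_add]⟩
  | single v r =>
    refine ⟨∑ i, (v i).natAbs, fun k' hk' => ?_⟩
    refine ⟨MvPolynomial.monomial (Finsupp.equivFunOnFinite.symm fun i => (k' + v i).toNat) r, ?_⟩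
    have : expHom m (Finsupp.equivFunOnFinite.symm fun i => (k' + v i).toNat)
        = (fun _ => (k' : ℤ)) + v := by
      ext i
      have h : (v i).natAbs ≤ ∑ i, (v i).natAbs :=
        single_le_sum (f := fun i => (v i).natAbs) (fun _ _ => Nat.zero_le _) (mem_univ i)
      simp only [expHom, AddMonoidHom.coe_mk, ZeroHom.coe_mk, Finsupp.equivFunOnFinite_symm_apply_apply,
        Pi.add_apply]
      omega
    rw [mono, AddMonoidAlgebra.single_mul_single, one_mul, ← this]
    exact AddMonoidAlgebra.mapDomain_single.symm

theorem eval_polyIncl {K : Type*} [Field K] [Algebra ℂ K] {ρ : Latt m → K} (hρ : IsChar ρ)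
    (g : MvPolynomial (Fin m) ℂ) :
    hρ.eval (polyIncl m g) = MvPolynomial.aeval (fun i => ρ (Pi.single i 1)) g := by
  have : hρ.eval.comp (polyIncl m) = MvPolynomial.aeval fun i => ρ (Pi.single i 1) := by
    apply MvPolynomial.algHom_ext
    intro i
    rw [AlgHom.comp_apply, polyIncl_X, hρ.eval_mono, MvPolynomial.aeval_X]
  rw [← this, AlgHom.comp_apply]

theorem eval_toFun (f : Laurent m) : (isChar_toFun_mono m).eval f = toFun f := by
  have : (isChar_toFun_mono m).eval = Algebra.algHom ℂ (Laurent m) (FunField m) :=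
    algHom_ext_mono fun v => by rw [IsChar.eval_mono]; rfl
  rw [this]
  rfl

theorem algebraicIndependent_coord : AlgebraicIndependent ℂ (coord m) := by
  intro f g h
  have h' : MvPolynomial.aeval (fun i => toFun (mono (Pi.single i 1))) f
      = MvPolynomial.aeval (fun i => toFun (mono (Pi.single i 1))) g := h
  rw [← eval_polyIncl (isChar_toFun_mono m), ← eval_polyIncl (isChar_toFun_mono m), eval_toFun,
    eval_toFun] at h'
  exact polyIncl_injective (toFun_injective h')

/-- The field has transcendence degree at least `m`, so `m` elements generating it form a
transcendence basis; a relation between Laurent monomials in them becomes polynomial after clearing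
denominators. -/
theorem eval_injective_of_adjoin_eq_top {ρ : Latt m → FunField m} (hρ : IsChar ρ)
    (hgen : IntermediateField.adjoin ℂ (Set.range ρ) = ⊤) : Function.Injective hρ.eval := by
  set x : Fin m → FunField m := fun i => ρ (Pi.single i 1) with hx
  have htop : IntermediateField.adjoin ℂ (Set.range x) = ⊤ := by
    rw [eq_top_iff, ← hgen, IntermediateField.adjoin_le_iff]
    rintro _ ⟨v, rfl⟩
    rw [hρ.apply_eq_prod]
    exact prod_mem fun i _ => zpow_mem (IntermediateField.subset_adjoin ℂ _ (Set.mem_range_self i)) _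
  have halg : Algebra.IsAlgebraic (Algebra.adjoin ℂ (Set.range x)) (FunField m) := by
    constructor
    intro y
    have hy : y ∈ IntermediateField.adjoin ℂ (Set.range x) := by rw [htop]; trivial
    rw [IntermediateField.mem_adjoin_iff_div] at hy
    obtain ⟨r, hr, s, hs, rfl⟩ := hy
    rw [div_eq_mul_inv]
    exact (isAlgebraic_algebraMap (⟨r, hr⟩ : Algebra.adjoin ℂ (Set.range x))).mul
      (isAlgebraic_algebraMap (⟨s, hs⟩ : Algebra.adjoin ℂ (Set.range x))).inv
  have hle : Cardinal.mk (Fin m) ≤ Algebra.trdeg ℂ (FunField m) :=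
    (algebraicIndependent_coord (m := m)).cardinalMk_le_trdeg
  have hind : AlgebraicIndependent ℂ x :=
    (Algebra.IsAlgebraic.isTranscendenceBasis_of_le_trdeg_of_finite ℂ x hle).1
  rw [injective_iff_map_eq_zero]
  intro f hf
  obtain ⟨k, hk⟩ := exists_mono_mul_eq_polyIncl f
  obtain ⟨g, hg⟩ := hk k le_rfl
  have h0 : MvPolynomial.aeval x g = 0 := by
    rw [hx, ← eval_polyIncl hρ, ← hg, map_mul, hf, mul_zero]
  have hg0 : g = 0 := hind (by rw [h0, map_zero])
  rw [hg0, map_zero] at hg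
  exact mono_injective_mul (v := fun _ => (k : ℤ)) (by rw [hg, mul_zero])

/-- A point of the torus that generates the function field of the torus defines a birational map. -/
theorem exists_birMap {ρ : Latt m → FunField m} (hρ : IsChar ρ)
    (hgen : IntermediateField.adjoin ℂ (Set.range ρ) = ⊤) :
    ∃ φ : BirMap m, ∀ f, φ (toFun f) = hρ.eval f := by
  let ψ : FunField m →ₐ[ℂ] FunField m :=
    IsFractionRing.liftAlgHom (g := hρ.eval) (eval_injective_of_adjoin_eq_top hρ hgen)
  have hψ : ∀ f, ψ (toFun f) = hρ.eval f := fun f =>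
    IsFractionRing.lift_algebraMap (eval_injective_of_adjoin_eq_top hρ hgen) f
  have hsurj : Function.Surjective ψ := by
    rw [← AlgHom.fieldRange_eq_top, eq_top_iff, ← hgen, IntermediateField.adjoin_le_iff]
    rintro _ ⟨v, rfl⟩
    exact ⟨toFun (mono v), (hψ _).trans (hρ.eval_mono v)⟩
  exact ⟨AlgEquiv.ofBijective ψ ⟨ψ.toRingHom.injective, hsurj⟩, hψ⟩

theorem adjoin_range_mono : IntermediateField.adjoin ℂ
    (Set.range fun v : Latt m => toFun (mono v)) = ⊤ := by
  rw [eq_top_iff]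
  intro y _
  have h : ∀ f : Laurent m, toFun f ∈ IntermediateField.adjoin ℂ
      (Set.range fun v : Latt m => toFun (mono v)) := fun f => by
    rw [← eval_toFun]
    exact IsChar.eval_mem _ fun v _ => IntermediateField.subset_adjoin ℂ _ (Set.mem_range_self v)
  obtain ⟨a, b, _, rfl⟩ := IsFractionRing.div_surjective (A := Laurent m) y
  exact div_mem (h a) (h b)

end auto

/-! ### Homogeneous Laurent polynomials -/

/-- `f` is homogeneous of degree `a` for the grading of `ℂ[N]` defined by `w ∈ M`. -/
def HasDeg {n : ℕ} (w : DualLatt n) (a : ℤ) (f : Laurent n) : Prop :=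
  ∀ v ∈ f.coeff.support, w v = a

section HasDeg

variable {n : ℕ} {w : DualLatt n}

theorem hasDeg_mono (v : Latt n) : HasDeg w (w v) (mono v) :=
  AddMonoidAlgebra.single_mem_gradeBy (R := ℂ) w v 1

theorem hasDeg_one : HasDeg w 0 (1 : Laurent n) := by
  simpa [mono_zero] using hasDeg_mono (w := w) 0

theorem HasDeg.mul {a b : ℤ} {f g : Laurent n} (hf : HasDeg w a f) (hg : HasDeg w b g) :
    HasDeg w (a + b) (f * g) :=
  SetLike.GradedMul.mul_mem (A := (AddMonoidAlgebra.gradeBy ℂ w.toAddMonoidHom)) hf hg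

theorem HasDeg.sum {κ : Type*} {t : Finset κ} {a : ℤ} {f : κ → Laurent n}
    (hf : ∀ k ∈ t, HasDeg w a (f k)) : HasDeg w a (∑ k ∈ t, f k) :=
  Submodule.sum_mem (AddMonoidAlgebra.gradeBy ℂ w a) hf

theorem HasDeg.pow {f : Laurent n} (hf : HasDeg w 0 f) (k : ℕ) : HasDeg w 0 (f ^ k) := by
  induction k with
  | zero => simpa using hasDeg_one
  | succ k ih => rw [pow_succ]; simpa using ih.mul hf

theorem HasDeg.prod {κ : Type*} {t : Finset κ} {f : κ → Laurent n}
    (hf : ∀ k ∈ t, HasDeg w 0 (f k)) : HasDeg w 0 (∏ k ∈ t, f k) := by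
  classical
  induction t using Finset.induction_on with
  | empty => simpa using hasDeg_one
  | insert k t hk ih =>
    rw [prod_insert hk]
    simpa using (hf k (mem_insert_self _ _)).mul (ih fun j hj => hf j (mem_insert_of_mem hj))

theorem IsMutation.map_of_hasDeg {F : Laurent n} {μ : BirMap n} (hμ : IsMutation w F μ)
    {f : Laurent n} (hf : HasDeg w 0 f) : μ (toFun f) = toFun f := by
  rw [eq_sum_smul_mono f]
  simp only [toFun, ← Algebra.algHom_apply ℂ (Laurent n) (FunField n), map_sum, map_smul]
  refine sum_congr rfl fun v hv => ?_
  have := hμ.map_mono v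
  rw [hf v hv, neg_zero, zpow_zero, mul_one] at this
  exact congrArg _ this

/-- Monomials in `w^⊥` are unchanged, so the field generated by the images contains `F`. Dividing by
powers of `F` recovers every monomial, which makes the substitution birational. -/
theorem exists_isMutation {F : Laurent n} (hF0 : F ≠ 0) (hF : HasDeg w 0 F) :
    ∃ μ : BirMap n, IsMutation (-w) F μ := by
  have hF0' : toFun F ≠ 0 := fun h => hF0 (toFun_injective (by rw [h, toFun, map_zero]))
  have hρ := (isChar_toFun_mono n).mul_prod_zpow (fun _ : Unit => toFun F) (fun _ => hF0')
    (fun _ => w.toAddMonoidHom)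
  have hρv : ∀ v, toFun (mono v) * ∏ i : Unit, toFun F ^ w.toAddMonoidHom v
      = toFun (mono v) * toFun F ^ w v := fun v => by simp
  set E := IntermediateField.adjoin ℂ (Set.range
    fun v => toFun (mono v) * ∏ i : Unit, toFun F ^ w.toAddMonoidHom v) with hE
  have hmem : ∀ v, toFun (mono v) * toFun F ^ w v ∈ E := fun v =>
    IntermediateField.subset_adjoin ℂ _ ⟨v, hρv v⟩
  have hFmem : toFun F ∈ E := by
    rw [← eval_toFun]
    refine IsChar.eval_mem _ fun v hv => ?_
    have := hmem v
    rwa [hF v hv, zpow_zero, mul_one] at this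
  obtain ⟨μ, hμ⟩ := exists_birMap hρ (by
    rw [← hE, eq_top_iff, ← adjoin_range_mono, IntermediateField.adjoin_le_iff]
    rintro _ ⟨v, rfl⟩
    have := mul_mem (hmem v) (inv_mem (zpow_mem hFmem (w v)))
    rwa [mul_assoc, mul_inv_cancel₀ (zpow_ne_zero _ hF0'), mul_one] at this)
  refine ⟨μ, hF0, fun v hv => by rw [LinearMap.neg_apply, hF v hv, neg_zero], fun v => ?_⟩
  rw [hμ, IsChar.eval_mono, hρv, LinearMap.neg_apply, neg_neg]

end HasDeg

/-! ### Evaluation at the unit of the torus -/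

theorem isChar_one (n : ℕ) : IsChar fun _ : Latt n => (1 : ℂ) := ⟨rfl, by simp⟩

/-- Evaluation of a Laurent polynomial at the unit element of the torus. -/
def aug (n : ℕ) : Laurent n →ₐ[ℂ] ℂ := (isChar_one n).eval

@[simp] theorem aug_mono {n : ℕ} (v : Latt n) : aug n (mono v) = 1 := (isChar_one n).eval_mono v

/-! ### The factors of the mutations -/

section factor

variable {n c : ℕ} {ι : Type*} [DecidableEq ι] [Fintype ι]
  {Y : SmoothCompleteFan n ι} {L : Fin c → Y.Pic}

/-- The factors `F_i` of the mutations attached to a nef partition, an amenable collection and a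
choice of distinguished rays. -/
def factor (P : NefPartition Y L) (u : Fin c → DualLatt n) (s : Fin c → ι) (i : Fin c) :
    Laurent n :=
  mono (-Y.ray (s i)) * ∑ k ∈ P.S i.castSucc, mono (Y.ray k) *
    -- The truncation `toNat` loses nothing under amenability, since `⟨u_j, v_k⟩ ≥ 0` for `k ∈ S_i`
    -- and `j < i`.
    ∏ j : Fin c, if _h : j < i then factor P u s j ^ (u j (Y.ray k)).toNat else 1
termination_by i

variable {P : NefPartition Y L} {u : Fin c → DualLatt n} {s : Fin c → ι}

theorem mono_mul_factor (i : Fin c) : mono (Y.ray (s i)) * factor P u s i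
    = ∑ k ∈ P.S i.castSucc, mono (Y.ray k) *
      ∏ j with j < i, factor P u s j ^ (u j (Y.ray k)).toNat := by
  rw [factor, mono_neg_mul]
  simp only [prod_filter, dite_eq_ite]

/-- On `S_i` the pairing with `u_j` is constant, equal to `-1` for `j = i` and `0` for `j > i`, so
`z^{v_{s_i}} F_i` is homogeneous of the degree of `z^{v_{s_i}}`. Besides `F_i ∈ ℂ[u_i^⊥]`, this
shows that later mutations fix `F_i`. -/
theorem hasDeg_factor (hu : P.IsAmenable u) (hs : ∀ i, s i ∈ P.S i.castSucc) (i : Fin c) :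
    ∀ j, i ≤ j → HasDeg (u j) 0 (factor P u s i) := by
  induction i using WellFoundedLT.induction with
  | ind i ih =>
    intro j hij
    have hval : ∀ k ∈ P.S i.castSucc, u j (Y.ray k) = u j (Y.ray (s i)) := by
      intro k hk
      rcases hij.eq_or_lt with rfl | hij
      · rw [hu.neg_one _ k hk, hu.neg_one _ _ (hs _)]
      · rw [hu.zero j i.castSucc (by simpa using hij) k hk,
          hu.zero j i.castSucc (by simpa using hij) _ (hs i)]
    have h : HasDeg (u j) (u j (Y.ray (s i))) (mono (Y.ray (s i)) * factor P u s i) := by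
      rw [mono_mul_factor]
      refine HasDeg.sum fun k hk => ?_
      rw [← hval k hk, ← add_zero (u j (Y.ray k))]
      refine (hasDeg_mono _).mul (HasDeg.prod fun l hl => ?_)
      have hl : l < i := by simpa using hl
      exact (ih l hl j (hl.le.trans hij)).pow _
    have h' := (hasDeg_mono (w := u j) (-Y.ray (s i))).mul h
    rw [← mul_assoc, ← mono_add, neg_add_cancel, mono_zero, one_mul, map_neg, neg_add_cancel] at h'
    exact h'

/-- The recursion for the factors is subtraction-free. Positivity at the unit gives nonvanishing,
and later supplies positive weights for the digraph. -/
theorem exists_aug_factor_eq (hs : ∀ i, s i ∈ P.S i.castSucc) (i : Fin c) :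
    ∃ t : ℝ, 0 < t ∧ aug n (factor P u s i) = t := by
  induction i using WellFoundedLT.induction with
  | ind i ih =>
    have ih' : ∀ j, ∃ t : ℝ, 0 < t ∧ (j < i → aug n (factor P u s j) = t) := fun j => by
      by_cases h : j < i
      · obtain ⟨t, ht, h'⟩ := ih j h
        exact ⟨t, ht, fun _ => h'⟩
      · exact ⟨1, one_pos, fun h' => absurd h' h⟩
    choose t ht ht' using ih'
    refine ⟨∑ k ∈ P.S i.castSucc, ∏ j with j < i, t j ^ (u j (Y.ray k)).toNat,
      sum_pos (fun k _ => prod_pos fun j _ => pow_pos (ht j) _) ⟨s i, hs i⟩, ?_⟩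
    have h := congrArg (aug n) (mono_mul_factor (P := P) (u := u) (s := s) i)
    simp only [map_mul, aug_mono, one_mul, map_sum, map_prod, map_pow] at h
    rw [h]
    push_cast
    refine sum_congr rfl fun k _ => prod_congr rfl fun j hj => ?_
    rw [ht' j (by simpa using hj)]

theorem factor_ne_zero (hs : ∀ i, s i ∈ P.S i.castSucc) (i : Fin c) : factor P u s i ≠ 0 := by
  intro h
  obtain ⟨t, ht, h'⟩ := exists_aug_factor_eq (P := P) (u := u) hs i
  rw [h, map_zero] at h'
  exact ht.ne (by exact_mod_cast h')

/-- The relation between the values of `F_i` at a point `r` of the torus and the value of `G_i` at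
the point obtained from `r` by the mutations. -/
theorem eval_factor_eq_mul_sum {K : Type*} [Field K] [Algebra ℂ K] (hu : P.IsAmenable u)
    {r : Latt n → K} (hr : IsChar r) {φ : Fin c → K} (hφ : ∀ i, φ i ≠ 0) (i : Fin c)
    (h : ∀ j < i, φ j = hr.eval (factor P u s j)) :
    r (Y.ray (s i)) * hr.eval (factor P u s i)
      = φ i * ∑ k ∈ P.S i.castSucc, r (Y.ray k) * ∏ j, φ j ^ u j (Y.ray k) := by
  have h1 := congrArg hr.eval (mono_mul_factor (P := P) (u := u) (s := s) i)
  simp only [map_mul, IsChar.eval_mono, map_sum, map_prod, map_pow] at h1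
  rw [h1, mul_sum]
  refine sum_congr rfl fun k hk => ?_
  -- For `k ∈ S_i` the factor `j = i` contributes `(φ i)⁻¹`, those with `j > i` contribute `1`, and
  -- those with `j < i` are the ones in the recursion.
  have h2 : ∏ j, φ j ^ u j (Y.ray k)
      = (φ i)⁻¹ * ∏ j with j < i, hr.eval (factor P u s j) ^ (u j (Y.ray k)).toNat := by
    rw [← mul_prod_erase univ _ (mem_univ i), hu.neg_one i k hk, zpow_neg_one, prod_filter]
    congr 1
    rw [← mul_prod_erase univ _ (mem_univ i), if_neg (lt_irrefl i), one_mul]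
    refine prod_congr rfl fun j hj => ?_
    split_ifs with hji
    · rw [← h j hji, ← zpow_natCast,
        Int.toNat_of_nonneg (hu.nonneg j i.castSucc (by simpa using hji) k hk)]
    · have : i < j := lt_of_le_of_ne (not_lt.1 hji) (ne_of_mem_erase hj).symm
      rw [hu.zero j i.castSucc (by simpa using this) k hk, zpow_zero]
  rw [h2]
  field_simp [hφ i]

/-- The pull-back of the superpotential along all mutations. -/
def totalPull (P : NefPartition Y L) (u : Fin c → DualLatt n) (s : Fin c → ι) : Laurent n :=
  ∑ i, mono (Y.ray (s i)) + ∑ k ∈ P.S (Fin.last c), mono (Y.ray k) *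
    ∏ j, factor P u s j ^ (u j (Y.ray k)).toNat

/-- If the `φ_i` are the values of the factors at a point `r`, the value of `totalPull` at `r` is the
value of the superpotential at the point obtained from `r` by the mutations. -/
theorem eval_totalPull {K : Type*} [Field K] [Algebra ℂ K] (hu : P.IsAmenable u)
    {r : Latt n → K} (hr : IsChar r) {φ : Fin c → K} (hφ : ∀ i, φ i ≠ 0)
    (h : ∀ j, φ j = hr.eval (factor P u s j)) :
    hr.eval (totalPull P u s) = ∑ k, r (Y.ray k) * ∏ j, φ j ^ u j (Y.ray k) := by
  rw [← sum_fiberwise univ P.part, Fin.sum_univ_castSucc, totalPull, map_add, map_sum, map_sum]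
  congr 1
  -- Before the mutation `i` the block `S_i` has become `z^{v_{s_i}} F_i`; that mutation divides it
  -- by `F_i`, leaving the single monomial `z^{v_{s_i}}`.
  · refine sum_congr rfl fun i _ => ?_
    have := eval_factor_eq_mul_sum (s := s) hu hr hφ i fun j _ => h j
    rw [← h, mul_comm] at this
    rw [IsChar.eval_mono]
    exact mul_left_cancel₀ (hφ i) this
  · refine sum_congr rfl fun k hk => ?_
    rw [map_mul, IsChar.eval_mono, map_prod]
    congr 1
    refine prod_congr rfl fun j _ => ?_
    rw [map_pow, ← h, ← zpow_natCast, Int.toNat_of_nonneg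
      (hu.nonneg j (Fin.last c) (Fin.castSucc_lt_last j) k hk)]

end factor

/-! ### Iterated pull-backs -/

section iterPull

variable {n c : ℕ}

theorem iterPull_zero (μ : Fin c → BirMap n) : iterPull μ 0 = AlgEquiv.refl := rfl

theorem iterPull_succ (μ : Fin c → BirMap n) (i : Fin c) (x : FunField n) :
    iterPull μ i.succ x = μ i (iterPull μ i.castSucc x) := by
  rw [iterPull, Fin.induction_succ]
  rfl

/-- Each factor is fixed by the mutations that come after it, so the powers of the factors simply
accumulate. -/
theorem iterPull_mono {u : Fin c → DualLatt n} {F : Fin c → Laurent n} {μ : Fin c → BirMap n}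
    (hμ : ∀ i, IsMutation (-u i) (F i) (μ i)) (v : Latt n) (j : Fin (c + 1))
    (hF : ∀ i i', i < i' → i'.castSucc < j → HasDeg (u i') 0 (F i)) :
    iterPull μ j (toFun (mono v))
      = toFun (mono v) * ∏ i with i.castSucc < j, toFun (F i) ^ u i v := by
  induction j using Fin.induction with
  | zero => simp [iterPull_zero]
  | succ k ih =>
    have hset : ({i | i.castSucc < k.succ} : Finset (Fin c))
        = insert k ({i | i.castSucc < k.castSucc} : Finset (Fin c)) := by
      ext i
      simp [Fin.castSucc_lt_succ_iff, le_iff_eq_or_lt]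
    rw [iterPull_succ, ih fun i i' h h' => hF i i' h (h'.trans Fin.castSucc_lt_succ), map_mul,
      (hμ k).map_mono, map_prod, hset, prod_insert (by simp), mul_assoc, LinearMap.neg_apply,
      neg_neg]
    congr 2
    refine prod_congr rfl fun i hi => ?_
    have hik : i < k := by simpa using hi
    rw [map_zpow₀, (hμ k).map_of_hasDeg]
    intro v hv
    rw [LinearMap.neg_apply, hF i k hik Fin.castSucc_lt_succ v hv, neg_zero]

variable {ι : Type*} [DecidableEq ι] [Fintype ι] {Y : SmoothCompleteFan n ι} {L : Fin c → Y.Pic}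
  {P : NefPartition Y L} {u : Fin c → DualLatt n} {s : Fin c → ι} {μ : Fin c → BirMap n}

/-- Only the factors before `i` enter, so the defining equations of a mirror determine its factors
by induction. -/
theorem iterPull_G {F : Fin c → Laurent n} (hu : P.IsAmenable u)
    (hs : ∀ i, s i ∈ P.S i.castSucc)
    (hμ : ∀ i, IsMutation (-u i) (F i) (μ i)) (i : Fin c) (hF : ∀ j < i, F j = factor P u s j) :
    iterPull μ i.castSucc (toFun (P.G i.castSucc))
      = toFun (mono (Y.ray (s i)) * factor P u s i) := by
  rw [mono_mul_factor, NefPartition.G]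
  simp only [toFun, map_sum, map_mul, map_prod, map_pow]
  refine sum_congr rfl fun k hk => ?_
  rw [iterPull_mono hμ]
  · congr 1
    refine prod_congr (by ext; simp) fun j hj => ?_
    have hj : j < i := by simpa using hj
    rw [hF j hj, ← zpow_natCast,
      Int.toNat_of_nonneg (hu.nonneg j i.castSucc (by simpa using hj) k hk)]
  · intro j j' hj hj'
    have hj' : j' < i := by simpa using hj'
    rw [hF j (hj.trans hj')]
    exact hasDeg_factor hu hs j j' hj.le

theorem iterPull_superpotential (hu : P.IsAmenable u) (hs : ∀ i, s i ∈ P.S i.castSucc)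
    (hμ : ∀ i, IsMutation (-u i) (factor P u s i) (μ i)) :
    iterPull μ (Fin.last c) (toFun (superpotential Y)) = toFun (totalPull P u s) := by
  have h := eval_totalPull (s := s) (φ := fun i => toFun (factor P u s i)) hu (isChar_toFun_mono n)
    (fun i h => factor_ne_zero hs i (toFun_injective (by rw [h, toFun, map_zero])))
    fun i => (eval_toFun _).symm
  rw [eval_toFun] at h
  rw [h, superpotential, toFun, map_sum, map_sum]
  refine sum_congr rfl fun k _ => ?_
  rw [iterPull_mono hμ _ _ fun i i' hi _ => hasDeg_factor hu hs i i' hi.le,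
    filter_true_of_mem fun i _ => Fin.castSucc_lt_last i]

/-- The data of a Laurent polynomial mirror are determined by the choice of coordinates. -/
theorem IsLaurentMirror.exists_eq {f : Laurent (n - c)} (hu : P.IsAmenable u)
    (hs : ∀ i, s i ∈ P.S i.castSucc) (hf : IsLaurentMirror P u s f) :
    ∃ q : Latt n →+ Latt (n - c), Function.Surjective q ∧
      q.ker = AddSubgroup.closure (Set.range fun i => Y.ray (s i)) ∧
      f = AddMonoidAlgebra.mapDomain q (totalPull P u s) := by
  obtain ⟨F, μ, H, q, hμ, hF, hH, hq, hker, rfl⟩ := hf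
  have hFeq : ∀ i, F i = factor P u s i := by
    intro i
    induction i using WellFoundedLT.induction with
    | ind i ih =>
      have := hF i
      rw [iterPull_G hu hs hμ i ih] at this
      exact mono_injective_mul (toFun_injective this)
  obtain rfl : F = factor P u s := funext hFeq
  refine ⟨q, hq, hker, ?_⟩
  rw [iterPull_superpotential hu hs hμ] at hH
  rw [toFun_injective hH]

theorem exists_isLaurentMirror (hu : P.IsAmenable u) (hs : ∀ i, s i ∈ P.S i.castSucc)
    {q : Latt n →+ Latt (n - c)} (hq : Function.Surjective q)
    (hker : q.ker = AddSubgroup.closure (Set.range fun i => Y.ray (s i))) :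
    ∃ f, IsLaurentMirror P u s f := by
  choose μ hμ using fun i =>
    exists_isMutation (factor_ne_zero (P := P) (u := u) hs i) (hasDeg_factor hu hs i i le_rfl)
  exact ⟨_, factor P u s, μ, totalPull P u s, q, hμ,
    fun i => (iterPull_G hu hs hμ i fun _ _ => rfl).symm,
    (iterPull_superpotential hu hs hμ).symm, hq, hker, rfl⟩

end iterPull

/-! ### The splitting of the lattice defined by an amenable collection -/

/-- The splitting of `N` into the image of `l`, on which the `u_i` vanish, and the lattice spanned
by the `b_i`, on which `q` vanishes. -/
structure IsSplitting {n m c : ℕ} (u : Fin c → DualLatt n) (q : Latt n →+ Latt m)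
    (l : Latt m →+ Latt n) (b : Fin c → Latt n) : Prop where
  u_l : ∀ i w, u i (l w) = 0
  q_l : ∀ w, q (l w) = w
  u_b : ∀ i j, u i (b j) = if i = j then 1 else 0
  q_b : ∀ j, q (b j) = 0
  eq_add : ∀ v, v = l (q v) + ∑ i, u i v • b i

section splitting

theorem mem_closure_range_iff {n c : ℕ} {x : Fin c → Latt n} {v : Latt n} :
    v ∈ AddSubgroup.closure (Set.range x) ↔ ∃ a : Fin c → ℤ, ∑ i, a i • x i = v := by
  rw [← Submodule.mem_span_range_iff_exists_fun (R := ℤ), ← Submodule.span_int_eq_addSubgroupClosure]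
  rfl

variable {n c : ℕ} {ι : Type*} [DecidableEq ι] [Fintype ι]
  {Y : SmoothCompleteFan n ι} {L : Fin c → Y.Pic}
  {P : NefPartition Y L} {u : Fin c → DualLatt n} {s : Fin c → ι}

/-- The matrix of pairings of the amenable collection with the distinguished rays. -/
def pairing (Y : SmoothCompleteFan n ι) (u : Fin c → DualLatt n) (s : Fin c → ι) :
    Matrix (Fin c) (Fin c) ℤ :=
  Matrix.of fun i j => u i (Y.ray (s j))

/-- The matrix is upper triangular with diagonal `-1`. Its integral inverse is what makes the
distinguished rays span a direct summand of `N`. -/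
theorem isUnit_det_pairing (hu : P.IsAmenable u) (hs : ∀ i, s i ∈ P.S i.castSucc) :
    IsUnit (pairing Y u s).det := by
  rw [Matrix.det_of_isUpperTriangular]
  · have h : ∀ i, pairing Y u s i i = -1 := fun i => hu.neg_one i _ (hs i)
    simp only [h, prod_const]
    exact isUnit_one.neg.pow _
  · intro i j hij
    exact hu.zero i j.castSucc (by simpa using hij) _ (hs j)

/-- The basis of the lattice spanned by the distinguished rays that is dual to the amenable
collection. -/
def dualVec (Y : SmoothCompleteFan n ι) (u : Fin c → DualLatt n) (s : Fin c → ι) (j : Fin c) :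
    Latt n :=
  ∑ i, (pairing Y u s)⁻¹ i j • Y.ray (s i)

theorem apply_dualVec (hu : P.IsAmenable u) (hs : ∀ i, s i ∈ P.S i.castSucc) (i j : Fin c) :
    u i (dualVec Y u s j) = if i = j then 1 else 0 := by
  have h := congrFun₂ (Matrix.mul_nonsing_inv _ (isUnit_det_pairing hu hs)) i j
  rw [Matrix.one_apply, Matrix.mul_apply] at h
  rw [← h, dualVec, map_sum]
  refine sum_congr rfl fun k _ => ?_
  rw [map_smul, smul_eq_mul, mul_comm]
  rfl

theorem apply_sum_smul_dualVec (hu : P.IsAmenable u) (hs : ∀ i, s i ∈ P.S i.castSucc)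
    (x : Fin c → ℤ) (i : Fin c) : u i (∑ j, x j • dualVec Y u s j) = x i := by
  rw [map_sum, sum_congr rfl fun j _ => (u i).map_smul (x j) _]
  simp [apply_dualVec hu hs]

theorem sum_smul_dualVec (hu : P.IsAmenable u) (hs : ∀ i, s i ∈ P.S i.castSucc) {v : Latt n}
    (hv : v ∈ AddSubgroup.closure (Set.range fun i => Y.ray (s i))) :
    ∑ i, u i v • dualVec Y u s i = v := by
  obtain ⟨x, rfl⟩ := mem_closure_range_iff.1 hv
  have h : ∀ k, ∑ i, (pairing Y u s)⁻¹ k i * ∑ j, pairing Y u s i j * x j = x k := by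
    intro k
    have := congrFun (Matrix.mulVec_mulVec x (pairing Y u s)⁻¹ (pairing Y u s)) k
    rw [Matrix.nonsing_inv_mul _ (isUnit_det_pairing hu hs), Matrix.one_mulVec] at this
    exact this
  simp only [dualVec, smul_sum, smul_smul]
  rw [sum_comm]
  refine sum_congr rfl fun k _ => ?_
  rw [← sum_smul]
  congr 1
  rw [← h k]
  refine sum_congr rfl fun i _ => ?_
  rw [mul_comm, map_sum]
  congr 1
  refine sum_congr rfl fun j _ => ?_
  rw [map_smul, smul_eq_mul, mul_comm]
  rfl

theorem exists_isSplitting {m : ℕ} (hu : P.IsAmenable u) (hs : ∀ i, s i ∈ P.S i.castSucc)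
    {q : Latt n →+ Latt m} (hq : Function.Surjective q)
    (hker : q.ker = AddSubgroup.closure (Set.range fun i => Y.ray (s i))) :
    ∃ l b, IsSplitting u q l b := by
  have hqs : ∀ i, q (Y.ray (s i)) = 0 := fun i => by
    rw [← AddMonoidHom.mem_ker, hker]
    exact AddSubgroup.subset_closure ⟨i, rfl⟩
  let b := dualVec Y u s
  have hqb : ∀ j, q (b j) = 0 := fun j => by
    simp [b, dualVec, map_sum, map_zsmul, hqs, -zsmul_eq_mul]
  choose x hx using fun k : Fin m => hq (Pi.single k 1)
  -- Lift the standard basis along `q` and subtract the components along the `b i`, moving the lifts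
  -- into `⋂ u_i^⊥` without changing their images.
  let l : Latt m →+ Latt n :=
    { toFun := fun w => ∑ k, w k • (x k - ∑ i, u i (x k) • b i)
      map_zero' := by simp
      map_add' := fun v w => by simp [add_smul, sum_add_distrib] }
  have hl : ∀ w, l w = ∑ k, w k • (x k - ∑ i, u i (x k) • b i) := fun _ => rfl
  have hql : ∀ w, q (l w) = w := fun w => by
    rw [hl, map_sum]
    simp only [map_zsmul, map_sub, map_sum, hqb, smul_zero, sum_const_zero, sub_zero, hx]
    conv_rhs => rw [← Finset.univ_sum_single w]
    refine sum_congr rfl fun i _ => ?_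
    rw [← Pi.single_smul, smul_eq_mul, mul_one]
  have hul : ∀ i w, u i (l w) = 0 := fun i w => by
    rw [hl, map_sum]
    refine sum_eq_zero fun k _ => ?_
    rw [map_smul, map_sub, apply_sum_smul_dualVec hu hs, sub_self, smul_zero]
  refine ⟨l, b, hul, hql, apply_dualVec hu hs, hqb, fun v => ?_⟩
  have h : v - l (q v) ∈ AddSubgroup.closure (Set.range fun i => Y.ray (s i)) := by
    rw [← hker, AddMonoidHom.mem_ker, map_sub, hql, sub_self]
  have := sum_smul_dualVec hu hs h
  simp only [map_sub, hul, sub_zero] at this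
  rw [← sub_eq_iff_eq_add']
  exact this.symm

/-- The map `(u_i) : N → ℤ^c` is onto, so its kernel is free of rank `n - c`. Projecting onto that
kernel along the distinguished rays realises the quotient. -/
theorem exists_quotient_coordinates (hu : P.IsAmenable u) (hs : ∀ i, s i ∈ P.S i.castSucc) :
    c ≤ n ∧ ∃ q : Latt n →+ Latt (n - c), Function.Surjective q ∧
      q.ker = AddSubgroup.closure (Set.range fun i => Y.ray (s i)) := by
  let U : Latt n →ₗ[ℤ] (Fin c → ℤ) := LinearMap.pi u
  have hU : ∀ v i, U v i = u i v := fun _ _ => rfl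
  let b := dualVec Y u s
  have hbU : ∀ v, U (∑ i, U v i • b i) = U v := fun v => by
    ext j
    rw [hU, apply_sum_smul_dualVec hu hs]
  have hsurj : Function.Surjective U := fun x =>
    ⟨∑ i, x i • b i, by ext j; rw [hU, apply_sum_smul_dualVec hu hs]⟩
  have hrank := Submodule.finrank_quotient_add_finrank (LinearMap.ker U)
  rw [(LinearMap.quotKerEquivOfSurjective U hsurj).finrank_eq, Module.finrank_fin_fun,
    Module.finrank_fin_fun] at hrank
  have e : LinearMap.ker U ≃ₗ[ℤ] Latt (n - c) :=
    LinearEquiv.ofFinrankEq _ _ (by rw [Module.finrank_fin_fun]; omega)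
  let pr : Latt n →ₗ[ℤ] LinearMap.ker U :=
    LinearMap.codRestrict _ (LinearMap.id - ∑ i, (u i).smulRight (b i)) fun v => by
      have := hbU v
      simp only [LinearMap.mem_ker, LinearMap.sub_apply, LinearMap.id_apply, LinearMap.sum_apply,
        LinearMap.smulRight_apply, map_sub]
      exact sub_eq_zero.2 this.symm
  have hpr : ∀ v, (pr v : Latt n) = v - ∑ i, u i v • b i := fun v => by
    simp [pr]
  refine ⟨by omega, (e.toLinearMap.comp pr).toAddMonoidHom, ?_, ?_⟩
  · refine e.surjective.comp fun v => ⟨v, Subtype.ext ?_⟩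
    rw [hpr]
    have : ∀ i, u i v = 0 := fun i => congrFun (LinearMap.mem_ker.1 v.2) i
    simp [this]
  · ext v
    have h : v ∈ (e.toLinearMap.comp pr).toAddMonoidHom.ker ↔ v = ∑ i, u i v • b i := by
      rw [AddMonoidHom.mem_ker, ← sub_eq_zero (a := v), ← hpr]
      simp
    rw [h]
    constructor
    · intro hv
      rw [hv]
      refine sum_mem fun i _ => zsmul_mem (sum_mem fun k _ => zsmul_mem ?_ _) _
      exact AddSubgroup.subset_closure ⟨k, rfl⟩
    · exact fun hv => (sum_smul_dualVec hu hs hv).symm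

end splitting

theorem IsChar.eval_mapDomain {n m : ℕ} {K : Type*} [Field K] [Algebra ℂ K] {ρ : Latt m → K}
    (hρ : IsChar ρ) (q : Latt n →+ Latt m) (f : Laurent n) :
    hρ.eval (AddMonoidAlgebra.mapDomain q f) = (hρ.comp q).eval f := by
  have : hρ.eval.comp (AddMonoidAlgebra.mapDomainAlgHom ℂ ℂ q) = (hρ.comp q).eval := by
    refine algHom_ext_mono fun v => ?_
    have h : AddMonoidAlgebra.mapDomainAlgHom ℂ ℂ q (mono v) = mono (q v) :=
      AddMonoidAlgebra.mapDomain_single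
    rw [AlgHom.comp_apply, h, IsChar.eval_mono, IsChar.eval_mono]
  rw [← this]
  rfl

/-! ### Rational functions that are regular at the unit of the torus -/

/-- The graph of the evaluation at the unit of the torus, on rational functions that are defined
and real there. -/
def valRing (m : ℕ) : Subring (FunField m × ℝ) where
  carrier := {x | ∃ a b : Laurent m, aug m b ≠ 0 ∧ x.1 * toFun b = toFun a ∧
    (x.2 : ℂ) * aug m b = aug m a}
  zero_mem' := ⟨0, 1, by simp, by simp [toFun], by simp⟩
  one_mem' := ⟨1, 1, by simp, by simp [toFun], by simp⟩
  add_mem' := by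
    rintro ⟨x, t⟩ ⟨y, t'⟩ ⟨a, b, hb, h1, h2⟩ ⟨a', b', hb', h1', h2'⟩
    refine ⟨a * b' + a' * b, b * b', by simp [hb, hb'], ?_, ?_⟩
    · simp only [toFun, Prod.mk_add_mk, map_add, map_mul] at *
      rw [← h1, ← h1']
      ring
    · simp only [Prod.mk_add_mk, map_add, map_mul, Complex.ofReal_add] at *
      rw [← h2, ← h2']
      ring
  mul_mem' := by
    rintro ⟨x, t⟩ ⟨y, t'⟩ ⟨a, b, hb, h1, h2⟩ ⟨a', b', hb', h1', h2'⟩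
    refine ⟨a * a', b * b', by simp [hb, hb'], ?_, ?_⟩
    · simp only [toFun, Prod.mk_mul_mk, map_mul] at *
      rw [← h1, ← h1']
      ring
    · simp only [Prod.mk_mul_mk, map_mul, Complex.ofReal_mul] at *
      rw [← h2, ← h2']
      ring
  neg_mem' := by
    rintro ⟨x, t⟩ ⟨a, b, hb, h1, h2⟩
    refine ⟨-a, b, hb, ?_, ?_⟩
    · simp only [toFun, Prod.neg_mk, map_neg] at *
      rw [← h1, neg_mul]
    · simp only [Prod.neg_mk, map_neg, Complex.ofReal_neg] at *
      rw [← h2, neg_mul]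

section valRing

variable {m : ℕ}

theorem toFun_mem_valRing {f : Laurent m} {t : ℝ} (h : aug m f = t) :
    (toFun f, t) ∈ valRing m :=
  ⟨f, 1, by simp, by simp [toFun], by simp [h]⟩

theorem ne_zero_of_mem_valRing {x : FunField m} {t : ℝ} (h : (x, t) ∈ valRing m) (ht : t ≠ 0) :
    x ≠ 0 := by
  rintro rfl
  obtain ⟨a, b, hb, h1, h2⟩ := h
  have ha : a = 0 := toFun_injective (by rw [← h1]; simp [toFun])
  rw [ha, map_zero] at h2
  simp_all

theorem inv_mem_valRing {x : FunField m} {t : ℝ} (h : (x, t) ∈ valRing m) (ht : t ≠ 0) :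
    (x⁻¹, t⁻¹) ∈ valRing m := by
  have hx := ne_zero_of_mem_valRing h ht
  obtain ⟨a, b, hb, h1, h2⟩ := h
  have ht' : (t : ℂ) ≠ 0 := by exact_mod_cast ht
  refine ⟨b, a, ?_, ?_, ?_⟩
  · rw [← h2]
    exact mul_ne_zero ht' hb
  · rw [← h1, inv_mul_cancel_left₀ hx]
  · rw [← h2]
    push_cast
    rw [inv_mul_cancel_left₀ ht']

theorem zpow_mem_valRing {x : FunField m} {t : ℝ} (h : (x, t) ∈ valRing m) (ht : t ≠ 0) (k : ℤ) :
    (x ^ k, t ^ k) ∈ valRing m := by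
  obtain ⟨k, rfl | rfl⟩ := k.eq_nat_or_neg
  · simpa using pow_mem h k
  · simpa using inv_mem_valRing (pow_mem h k) (pow_ne_zero k ht)

theorem prod_mem_valRing {κ : Type*} {s : Finset κ} {x : κ → FunField m} {t : κ → ℝ}
    (h : ∀ i ∈ s, (x i, t i) ∈ valRing m) : (∏ i ∈ s, x i, ∏ i ∈ s, t i) ∈ valRing m := by
  have := prod_mem h
  rwa [← Prod.mk.eta (p := ∏ i ∈ s, (x i, t i)), Prod.fst_prod, Prod.snd_prod] at this

end valRing

/-! ### The torus chart of the locus `G_1 = ⋯ = G_c = 1` -/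

section chart

variable {n m c : ℕ} {ι : Type*} [DecidableEq ι] [Fintype ι]
  {Y : SmoothCompleteFan n ι} {L : Fin c → Y.Pic}
  {P : NefPartition Y L} {u : Fin c → DualLatt n} {s : Fin c → ι}
  {q : Latt n →+ Latt m} {l : Latt m →+ Latt n} {b : Fin c → Latt n}

/-- A point of the locus `G_1 = ⋯ = G_c = 1` is determined by its restriction to the
sublattice `⋂ u_i^⊥`. -/
theorem apply_eq_mul_prod_eval_factor {K : Type*} [Field K] [Algebra ℂ K] (hu : P.IsAmenable u)
    (hqs : ∀ i, q (Y.ray (s i)) = 0) (hl : IsSplitting u q l b) {p : Latt n → K} (hp : IsChar p)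
    (hG : ∀ i : Fin c, ∑ k ∈ P.S i.castSucc, p (Y.ray k) = 1) :
    (∀ v, p v = p (l (q v)) * ∏ i, p (b i) ^ u i v) ∧
      ∀ i, p (b i) = ((hp.comp l).comp q).eval (factor P u s i) := by
  have h1 : ∀ v, p v = p (l (q v)) * ∏ i, p (b i) ^ u i v := by
    intro v
    conv_lhs => rw [hl.eq_add v]
    rw [hp.map_add, hp.map_sum]
    simp only [hp.map_zsmul]
  refine ⟨h1, fun i => ?_⟩
  induction i using WellFoundedLT.induction with
  | ind i ih =>
    -- At the point `p ∘ l ∘ q` the monomial `z^{v_{s_i}}` is `1`, and the sum on the right is the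
    -- value of `G_i` at `p`; so `G_i = 1` solves for `p (b i)`.
    have := eval_factor_eq_mul_sum (s := s) (φ := fun i => p (b i)) hu ((hp.comp l).comp q)
      (fun i => hp.ne_zero _) i ih
    rw [hqs, map_zero, hp.map_zero, one_mul] at this
    rw [this, sum_congr rfl fun k _ => (h1 (Y.ray k)).symm, hG, mul_one]

theorem apply_mem_adjoin {K : Type*} [Field K] [Algebra ℂ K] (hu : P.IsAmenable u)
    (hqs : ∀ i, q (Y.ray (s i)) = 0) (hl : IsSplitting u q l b) {p : Latt n → K} (hp : IsChar p)
    (hG : ∀ i : Fin c, ∑ k ∈ P.S i.castSucc, p (Y.ray k) = 1) (v : Latt n) :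
    p v ∈ IntermediateField.adjoin ℂ (Set.range fun w => p (l w)) := by
  obtain ⟨h1, h2⟩ := apply_eq_mul_prod_eval_factor hu hqs hl hp hG
  have hmem : ∀ w, p (l w) ∈ IntermediateField.adjoin ℂ (Set.range fun w => p (l w)) := fun w =>
    IntermediateField.subset_adjoin ℂ _ ⟨w, rfl⟩
  rw [h1 v]
  refine mul_mem (hmem _) (prod_mem fun i _ => zpow_mem ?_ _)
  rw [h2]
  exact IsChar.eval_mem _ fun v _ => hmem _

/-- The link between mirrors and geometry: the mirror is `W` on the locus, in the coordinates given
by `l`, and the locus does not involve `u` or `s`. -/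
theorem eval_mirror {K : Type*} [Field K] [Algebra ℂ K] (hu : P.IsAmenable u)
    (hqs : ∀ i, q (Y.ray (s i)) = 0) (hl : IsSplitting u q l b) {p : Latt n → K} (hp : IsChar p)
    (hG : ∀ i : Fin c, ∑ k ∈ P.S i.castSucc, p (Y.ray k) = 1) :
    (hp.comp l).eval (AddMonoidAlgebra.mapDomain q (totalPull P u s)) = ∑ k, p (Y.ray k) := by
  obtain ⟨h1, h2⟩ := apply_eq_mul_prod_eval_factor hu hqs hl hp hG
  rw [IsChar.eval_mapDomain, eval_totalPull hu _ (fun i => hp.ne_zero (b i)) h2]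
  exact sum_congr rfl fun k _ => (h1 _).symm

/-- The generic point of the locus `G_1 = ⋯ = G_c = 1`. -/
theorem exists_generic_point (hu : P.IsAmenable u) (hs : ∀ i, s i ∈ P.S i.castSucc)
    (hqs : ∀ i, q (Y.ray (s i)) = 0) (hl : IsSplitting u q l b) :
    ∃ (p : Latt n → FunField m) (t : Latt n → ℝ), IsChar p ∧ (∀ w, p (l w) = toFun (mono w)) ∧
      (∀ i : Fin c, ∑ k ∈ P.S i.castSucc, p (Y.ray k) = 1) ∧
      (∑ k, p (Y.ray k) = toFun (AddMonoidAlgebra.mapDomain q (totalPull P u s))) ∧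
      ∀ v, 0 < t v ∧ (p v, t v) ∈ valRing m := by
  choose t ht ht' using exists_aug_factor_eq (P := P) (u := u) hs
  have hr := (isChar_toFun_mono m).comp q
  set φ : Fin c → FunField m := fun i => hr.eval (factor P u s i) with hφ
  have hφmem : ∀ i, (φ i, t i) ∈ valRing m := fun i => by
    have : φ i = toFun (AddMonoidAlgebra.mapDomain q (factor P u s i)) := by
      rw [← eval_toFun, IsChar.eval_mapDomain]
    rw [this]
    exact toFun_mem_valRing (((isChar_one m).eval_mapDomain q _).trans (ht' i))
  have hφ0 : ∀ i, φ i ≠ 0 := fun i => ne_zero_of_mem_valRing (hφmem i) (ht i).ne'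
  have hp := hr.mul_prod_zpow φ hφ0 (fun i => (u i).toAddMonoidHom)
  -- The real values are those at the unit of the torus, where the monomial part `z^{q(v)}`
  -- contributes `1`.
  refine ⟨_, fun v => ∏ i, t i ^ u i v, hp, fun w => ?_, fun i => ?_, ?_, fun v => ⟨?_, ?_⟩⟩
  · simp [hl.q_l, hl.u_l]
  · have := eval_factor_eq_mul_sum (s := s) hu hr hφ0 i fun _ _ => rfl
    rw [hqs, mono_zero, toFun, map_one, one_mul] at this
    exact mul_left_cancel₀ (hφ0 i) (this.symm.trans (mul_one _).symm)
  · rw [← eval_toFun, IsChar.eval_mapDomain, eval_totalPull hu hr hφ0 fun _ => rfl]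
    rfl
  · exact prod_pos fun i _ => zpow_pos (ht i) _
  · have := mul_mem (toFun_mem_valRing (m := m) (f := mono (q v)) (t := 1) (by simp))
      (prod_mem_valRing fun i (_ : i ∈ univ) => zpow_mem_valRing (hφmem i) (ht i).ne' (u i v))
    rwa [Prod.mk_mul_mk, one_mul] at this

end chart

/-! ### The weighted digraph of a pair of partitions -/

section laplacian

set_option linter.unusedSectionVars false

variable {ι J : Type*} [Fintype ι] [Fintype J] [DecidableEq J]

/-- The functions `part, part' : ι → J` define a digraph on `J` with an edge from `part j` to
`part' j` for each `j`. The map `root` chooses a vertex in each connected component, and every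
component is strongly connected. -/
structure IsRoot (part part' : ι → J) (root : J → J) : Prop where
  idem : ∀ a, root (root a) = root a
  root_eq : ∀ j, root (part j) = root (part' j)
  reach : ∀ a, Relation.ReflTransGen (fun a b => ∃ j, part j = a ∧ part' j = b) a (root a)
  reach' : ∀ a, Relation.ReflTransGen (fun a b => ∃ j, part' j = a ∧ part j = b) a (root a)

theorem IsRoot.symm {part part' : ι → J} {root : J → J} (h : IsRoot part part' root) :
    IsRoot part' part root :=
  ⟨h.idem, fun j => (h.root_eq j).symm, h.reach', h.reach⟩

/-- A digraph with a positive circulation is a disjoint union of strongly connected digraphs. -/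
theorem exists_isRoot {part part' : ι → J} {l : ι → ℝ} (hl : ∀ j, 0 < l j)
    (hbal : ∀ a, ∑ j with part j = a, l j = ∑ j with part' j = a, l j) :
    ∃ root, IsRoot part part' root := by
  classical
  set rel : J → J → Prop := fun a b => ∃ j, part j = a ∧ part' j = b with hrel
  have hback : ∀ a b, rel a b → Relation.ReflTransGen rel b a := by
    rintro a b ⟨j₀, hja, hjb⟩
    -- No edge leaves the set `Z` of vertices reachable from `b`, so by balance none enters it; the
    -- edge `j₀` ends in `Z`, hence also starts there.
    let Z : Finset J := {z | Relation.ReflTransGen rel b z}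
    have hsum : ∀ f : ι → J, ∑ j with f j ∈ Z, l j = ∑ a ∈ Z, ∑ j with f j = a, l j := fun f => by
      rw [← sum_fiberwise_of_maps_to (s := {j | f j ∈ Z}) (t := Z) (g := f) (by simp)]
      refine sum_congr rfl fun a ha => sum_congr ?_ fun _ _ => rfl
      ext j
      simp only [mem_filter, mem_univ, true_and, and_iff_right_iff_imp]
      rintro rfl
      exact ha
    have heq : ∑ j with part j ∈ Z, l j = ∑ j with part' j ∈ Z, l j := by
      rw [hsum, hsum, sum_congr rfl fun a _ => hbal a]
    have hsub : ({j | part j ∈ Z} : Finset ι) ⊆ ({j | part' j ∈ Z} : Finset ι) := by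
      intro j hj
      simp only [Z, mem_filter, mem_univ, true_and] at hj ⊢
      exact hj.tail ⟨j, rfl, rfl⟩
    have hj₀ : j₀ ∈ ({j | part j ∈ Z} : Finset ι) := by
      by_contra h
      refine heq.not_lt (sum_lt_sum_of_subset hsub (i := j₀) ?_ h (hl _) fun j _ _ => (hl j).le)
      simp only [Z, mem_filter, mem_univ, true_and, hjb]
      exact Relation.ReflTransGen.refl
    simpa [Z, hja] using hj₀
  have hsymm : ∀ a b, Relation.ReflTransGen rel a b → Relation.ReflTransGen rel b a := by
    intro a b h
    induction h with
    | refl => exact .refl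
    | tail _ h ih => exact (hback _ _ h).trans ih
  let S : Setoid J := ⟨Relation.ReflTransGen rel, fun _ => .refl, fun h => hsymm _ _ h,
    fun h h' => h.trans h'⟩
  have hout : ∀ a, Relation.ReflTransGen rel (Quotient.out (Quotient.mk S a)) a := fun a =>
    Quotient.mk_out (s := S) a
  refine ⟨fun a => Quotient.out (Quotient.mk S a), ?_, fun j => ?_, fun a => hsymm _ _ (hout a),
    fun a => ?_⟩
  · intro a
    simp
  · exact congrArg _ (Quotient.sound (s := S) (Relation.ReflTransGen.single ⟨j, rfl, rfl⟩))
  · refine Relation.ReflTransGen.mono ?_ _ _ (hout a).swap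
    rintro x y ⟨j, h1, h2⟩
    exact ⟨j, h2, h1⟩

variable (part part' : ι → J) (root : J → J)

/-- The Laplace operator of the digraph with edge weights `x`. -/
def lapl {R V : Type*} [CommRing R] [AddCommGroup V] [Module R V] (x : ι → R) (z : J → V) (a : J) :
    V :=
  (∑ j with part' j = a, x j) • z a - ∑ j with part j = a, x j • z (part' j)

/-- The matrix of the Laplace operator on functions that vanish at the roots. -/
def lapMat {R : Type*} [CommRing R] (x : ι → R) :
    Matrix {a // root a ≠ a} {a // root a ≠ a} R :=
  Matrix.of fun a b => (if a = b then ∑ j with part' j = a.1, x j else 0)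
    - ∑ j with part j = a.1 ∧ part' j = b.1, x j

variable {part part' root}

section ring

variable {R V : Type*} [CommRing R] [AddCommGroup V] [Module R V]

theorem sum_nonroot_smul {x : ι → R} {f : ι → J} {t : Finset ι} {z : J → V}
    (hz : ∀ a, root a = a → z a = 0) :
    ∑ b : {a // root a ≠ a}, (∑ j ∈ t with f j = b.1, x j) • z b.1 = ∑ j ∈ t, x j • z (f j) := by
  have h1 : ∑ b : {a // root a ≠ a}, (∑ j ∈ t with f j = b.1, x j) • z b.1
      = ∑ b : J, (∑ j ∈ t with f j = b, x j) • z b := by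
    rw [← Finset.sum_subtype {a | root a ≠ a} (by simp)
      (fun b => (∑ j ∈ t with f j = b, x j) • z b)]
    refine sum_filter_of_ne fun a _ h hra => h ?_
    rw [hz a hra, smul_zero]
  rw [h1, ← sum_fiberwise t f]
  refine sum_congr rfl fun b _ => ?_
  rw [sum_smul]
  exact sum_congr rfl fun j hj => by rw [(mem_filter.1 hj).2]

theorem sum_lapMat_smul {x : ι → R} {z : J → V} (hz : ∀ a, root a = a → z a = 0)
    (a : {a // root a ≠ a}) :
    ∑ b, lapMat part part' root x a b • z b.1 = lapl part part' x z a.1 := by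
  simp only [lapMat, Matrix.of_apply, sub_smul, sum_sub_distrib, lapl, ite_smul, zero_smul]
  rw [Fintype.sum_ite_eq, ← sum_nonroot_smul (f := part') (x := x) hz]
  simp only [filter_filter]

/-- Extension of functions by zero to the roots. -/
def extZero (root : J → J) (z : {a // root a ≠ a} → V) (a : J) : V :=
  if h : root a ≠ a then z ⟨a, h⟩ else 0

theorem extZero_root (z : {a // root a ≠ a} → V) (a : J) (h : root a = a) :
    extZero root z a = 0 := dif_neg (not_not.2 h)

theorem extZero_coe (z : {a // root a ≠ a} → V) (a : {a // root a ≠ a}) :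
    extZero root z a.1 = z a := dif_pos a.2

theorem exists_lapl_eq {x : ι → R} (hdet : IsUnit (lapMat part part' root x).det) (w : J → V) :
    ∃ z : J → V, (∀ a, root a = a → z a = 0) ∧
      ∀ a, root a ≠ a → lapl part part' x z a = w a := by
  let N := (lapMat part part' root x)⁻¹
  refine ⟨extZero root fun a => ∑ b, N a b • w b.1, extZero_root _, fun a ha => ?_⟩
  rw [← sum_lapMat_smul (extZero_root _) ⟨a, ha⟩]
  simp only [extZero_coe, smul_sum, smul_smul]
  rw [sum_comm]
  have h : ∀ c, ∑ b, lapMat part part' root x ⟨a, ha⟩ b * N b c = if ⟨a, ha⟩ = c then 1 else 0 :=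
    fun c => by
      rw [← Matrix.mul_apply, Matrix.mul_nonsing_inv _ hdet, Matrix.one_apply]
  simp only [← sum_smul, h, ite_smul, one_smul, zero_smul, Fintype.sum_ite_eq]

theorem eq_zero_of_lapl_eq_zero {x : ι → R} (hdet : IsUnit (lapMat part part' root x).det)
    {z : J → V} (hz : ∀ a, root a = a → z a = 0)
    (h : ∀ a, root a ≠ a → lapl part part' x z a = 0) (a : J) : z a = 0 := by
  by_cases ha : root a = a
  · exact hz a ha
  let N := (lapMat part part' root x)⁻¹
  have h1 : ∀ b : {a // root a ≠ a}, ∑ c, N ⟨a, ha⟩ b • lapMat part part' root x b c • z c.1 = 0 :=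
    fun b => by rw [← smul_sum, sum_lapMat_smul hz, h _ b.2, smul_zero]
  have h2 : ∑ c : {a // root a ≠ a}, ∑ b, (N ⟨a, ha⟩ b * lapMat part part' root x b c) • z c.1
      = 0 := by
    rw [sum_comm]
    simp only [mul_smul]
    exact sum_eq_zero fun b _ => h1 b
  simp only [← sum_smul, ← Matrix.mul_apply] at h2
  rw [Matrix.nonsing_inv_mul _ hdet] at h2
  simpa [Matrix.one_apply] using h2

/-- A function on the vertices whose sum over each component vanishes is zero if it vanishes outside
the roots. -/
theorem eq_zero_of_sum_class {w : J → V}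
    (hw : ∀ a, root a ≠ a → w a = 0) (hs : ∀ r, ∑ a with root a = r, w a = 0) (a : J) :
    w a = 0 := by
  by_cases ha : root a = a
  · have := hs a
    rwa [sum_eq_single a] at this
    · intro b hb hba
      refine hw b fun h => hba ?_
      rw [← h]
      simpa using hb
    · simp [ha]
  · exact hw a ha

theorem sum_class_sum {f : ι → J} (r : J) (y : ι → V) :
    ∑ a with root a = r, ∑ j with f j = a, y j = ∑ j with root (f j) = r, y j := by
  rw [← sum_fiberwise_of_maps_to (s := {j | root (f j) = r}) (t := {a | root a = r}) (g := f)
    (by simp)]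
  refine sum_congr rfl fun a ha => sum_congr ?_ fun _ _ => rfl
  ext j
  simp only [mem_filter, mem_univ, true_and] at ha ⊢
  constructor
  · rintro rfl
    exact ⟨ha, rfl⟩
  · exact fun h => h.2

/-- Both ends of an edge lie in one component, so its two contributions cancel. -/
theorem sum_class_lapl (hr : IsRoot part part' root) (x : ι → R) (z : J → V) (r : J) :
    ∑ a with root a = r, lapl part part' x z a = 0 := by
  have h : ∀ a, (∑ j with part' j = a, x j) • z a = ∑ j with part' j = a, x j • z (part' j) :=
    fun a => by
      rw [sum_smul]
      exact sum_congr rfl fun j hj => by rw [(mem_filter.1 hj).2]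
  simp only [lapl, h, sum_sub_distrib, sum_class_sum, hr.root_eq, sub_self]

/-- The equation at a root is redundant: it is minus the sum of the others in its component. -/
theorem lapl_eq_zero (hr : IsRoot part part' root) {x : ι → R} {z : J → V}
    (h : ∀ a, root a ≠ a → lapl part part' x z a = 0) (a : J) : lapl part part' x z a = 0 :=
  eq_zero_of_sum_class h (sum_class_lapl hr x z) a

theorem lapl_add (x : ι → R) (z z' : J → V) (a : J) :
    lapl part part' x (z + z') a = lapl part part' x z a + lapl part part' x z' a := by
  simp only [lapl, Pi.add_apply, smul_add, sum_add_distrib]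
  abel

theorem lapl_sub (x : ι → R) (z z' : J → V) (a : J) :
    lapl part part' x (z - z') a = lapl part part' x z a - lapl part part' x z' a := by
  simp only [lapl, Pi.sub_apply, smul_sub, sum_sub_distrib]
  abel

/-- The stationary vector of the digraph, normalized to be `1` at the roots. -/
theorem exists_stationary {x : ι → R} (hdet : IsUnit (lapMat part part' root x).det) :
    ∃ B : J → R, (∀ a, root a = a → B a = 1) ∧
      ∀ a, root a ≠ a → lapl part part' x B a = 0 := by
  obtain ⟨z, hz, h⟩ := exists_lapl_eq hdet fun a => -lapl part part' x (1 : J → R) a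
  refine ⟨1 + z, fun a ha => by simp [hz a ha], fun a ha => ?_⟩
  rw [lapl_add, h a ha, add_neg_cancel]

theorem lapMat_map {R' : Type*} [CommRing R'] (f : R →+* R') (x : ι → R) :
    (lapMat part part' root x).map f = lapMat part part' root fun j => f (x j) := by
  ext a b
  simp only [lapMat, Matrix.map_apply, Matrix.of_apply, map_sub, map_sum]
  split_ifs <;> simp

theorem map_lapl {R' : Type*} [CommRing R'] (f : R →+* R') (x : ι → R) (B : J → R) (a : J) :
    f (lapl part part' x B a) = lapl part part' (fun j => f (x j)) (fun b => f (B b)) a := by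
  simp [lapl, map_sum]

end ring

section real

variable {x : ι → ℝ}

/-- Maximum principle. At a non-root the value is a weighted mean over the sources of the incoming
edges, so a positive maximum spreads backwards along edges until it reaches a root, where the value
is `0`. -/
theorem nonpos_of_harmonic (hr : IsRoot part part' root) (hx : ∀ j, 0 < x j) {W : J → ℝ}
    (h0 : ∀ a, root a = a → W a = 0)
    (hW : ∀ b, root b ≠ b → ∑ j with part' j = b, x j * (W b - W (part j)) = 0) (a : J) :
    W a ≤ 0 := by
  have : Nonempty J := ⟨a⟩
  obtain ⟨m, hm⟩ := Finite.exists_max W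
  refine (hm a).trans (not_lt.1 fun hpos => ?_)
  have key : ∀ b, Relation.ReflTransGen (fun a b => ∃ j, part' j = a ∧ part j = b) m b →
      W b = W m := by
    intro b hb
    induction hb with
    | refl => rfl
    | tail _ h ih =>
      obtain ⟨j, rfl, rfl⟩ := h
      have hnr : root (part' j) ≠ part' j := fun h => by
        rw [h0 _ h] at ih
        exact hpos.ne ih
      have hz := (sum_eq_zero_iff_of_nonneg fun i hi => mul_nonneg (hx i).le
        (sub_nonneg.2 (ih ▸ hm (part i)))).1 (hW _ hnr) j (by simp)
      have := (mul_eq_zero.1 hz).resolve_left (hx j).ne'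
      linarith
  have := key _ (hr.reach' m)
  rw [h0 _ (hr.idem m)] at this
  exact hpos.ne this

/-- A vector in the left kernel, extended by zero to the roots, is harmonic; the maximum principle
for it and its negative makes it vanish. -/
theorem det_lapMat_ne_zero (hr : IsRoot part part' root) (hx : ∀ j, 0 < x j) :
    (lapMat part part' root x).det ≠ 0 := by
  intro hdet
  obtain ⟨w, hw0, hw⟩ := Matrix.exists_vecMul_eq_zero_iff.2 hdet
  have hW : ∀ b, root b ≠ b →
      ∑ j with part' j = b, x j * (extZero root w b - extZero root w (part j)) = 0 := by
    intro b hb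
    have h1 := congrFun hw ⟨b, hb⟩
    simp only [Matrix.vecMul, dotProduct, lapMat, Matrix.of_apply, mul_sub, sum_sub_distrib,
      mul_ite, mul_zero, Fintype.sum_ite_eq', Pi.zero_apply] at h1
    have h2 := sum_nonroot_smul (root := root) (x := x) (f := part) (t := {j | part' j = b})
      (extZero_root w)
    simp only [filter_filter, smul_eq_mul, extZero_coe] at h2
    rw [sum_congr rfl fun j _ => mul_sub (x j) _ _, sum_sub_distrib, ← h2, ← sum_mul,
      ← extZero_coe w ⟨b, hb⟩] at *
    rw [← h1]
    congr 1
    · ring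
    · refine sum_congr rfl fun a _ => ?_
      rw [mul_comm]
      congr 2
      ext j
      simp [and_comm]
  have hle := nonpos_of_harmonic hr hx (extZero_root w) hW
  have hge := nonpos_of_harmonic hr hx (W := fun a => -extZero root w a)
    (fun a ha => by rw [extZero_root w a ha, neg_zero]) (fun b hb => by
      rw [← neg_eq_zero, ← sum_neg_distrib, ← hW b hb]
      exact sum_congr rfl fun j _ => by ring)
  refine hw0 (funext fun a => ?_)
  have h1 := hle a.1
  have h2 := hge a.1
  rw [extZero_coe] at h1 h2
  exact le_antisymm h1 (by simpa using h2)

/-- By the triangle inequality the Laplacian of `|B|` is nonpositive; its sum over a component is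
zero, so it vanishes. Uniqueness gives `B = |B|`, and a zero of `B` would spread along edges to a
root, where `B = 1`. -/
theorem stationary_pos (hr : IsRoot part part' root) (hx : ∀ j, 0 < x j) {B : J → ℝ}
    (hB1 : ∀ a, root a = a → B a = 1) (hB : ∀ a, root a ≠ a → lapl part part' x B a = 0)
    (a : J) : 0 < B a := by
  have hB' := lapl_eq_zero hr hB
  have hle : ∀ a, lapl part part' x (fun a => |B a|) a ≤ 0 := by
    intro a
    have hlam : 0 ≤ ∑ j with part' j = a, x j := sum_nonneg fun j _ => (hx j).le
    have h := hB' a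
    simp only [lapl, smul_eq_mul] at h ⊢
    rw [sub_eq_zero] at h
    rw [sub_nonpos]
    calc (∑ j with part' j = a, x j) * |B a| = |(∑ j with part' j = a, x j) * B a| := by
          rw [abs_mul, abs_of_nonneg hlam]
      _ = |∑ j with part j = a, x j * B (part' j)| := by rw [h]
      _ ≤ ∑ j with part j = a, |x j * B (part' j)| := abs_sum_le_sum_abs _ _
      _ = ∑ j with part j = a, x j * |B (part' j)| :=
          sum_congr rfl fun j _ => by rw [abs_mul, abs_of_pos (hx j)]
  have habs : ∀ a, lapl part part' x (fun a => |B a|) a = 0 := fun a =>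
    (sum_eq_zero_iff_of_nonpos fun b _ => hle b).1 (sum_class_lapl hr x _ (root a)) a (by simp)
  have hnonneg : ∀ a, 0 ≤ B a := fun a => by
    have := eq_zero_of_lapl_eq_zero (isUnit_iff_ne_zero.2 (det_lapMat_ne_zero hr hx))
      (z := (fun a => |B a|) - B) (fun a ha => by simp [hB1 a ha])
      (fun a _ => by rw [lapl_sub, habs, hB', sub_zero]) a
    rw [Pi.sub_apply, sub_eq_zero] at this
    exact this ▸ abs_nonneg _
  refine (hnonneg a).lt_of_ne fun h => ?_
  have key : ∀ b, Relation.ReflTransGen (fun a b => ∃ j, part j = a ∧ part' j = b) a b →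
      B b = 0 := by
    intro b hb
    induction hb with
    | refl => exact h.symm
    | tail _ h ih =>
      obtain ⟨j, rfl, rfl⟩ := h
      have := hB' (part j)
      simp only [lapl, ih, mul_zero, zero_sub, neg_eq_zero, smul_eq_mul] at this
      have hz := (sum_eq_zero_iff_of_nonneg fun i _ => mul_nonneg (hx i).le (hnonneg _)).1 this j
        (by simp)
      exact (mul_eq_zero.1 hz).resolve_left (hx j).ne'
  have := key _ (hr.reach a)
  rw [hB1 _ (hr.idem a)] at this
  exact one_ne_zero this

end real

end laplacian

/-! ### Changing the nef partition -/

section transition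

set_option linter.unusedSectionVars false

variable {n : ℕ} {ι J : Type*} [Fintype ι] [Fintype J] [DecidableEq J]
  {part part' : ι → J} {root : J → J}

/-- The twist of the point `p` of the torus by the cocharacters `-M_a`, evaluated at `B_a`. -/
def twist {K : Type*} [Field K] (p : Latt n → K) (M : J → DualLatt n) (B : J → K) (w : Latt n) : K :=
  p w * ∏ a, B a ^ (-(M a)).toAddMonoidHom w

variable {v : ι → Latt n} {M : J → DualLatt n}

section field

variable {K : Type*} [Field K] {p : Latt n → K} {B : J → K}

theorem isChar_twist (hp : IsChar p) (hB : ∀ a, B a ≠ 0) : IsChar (twist p M B) :=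
  hp.mul_prod_zpow B hB fun a => (-(M a)).toAddMonoidHom

theorem twist_ray (hB : ∀ a, B a ≠ 0)
    (hM : ∀ a j, M a (v j) = (if part j = a then 1 else 0) - if part' j = a then 1 else 0) (j : ι) :
    twist p M B (v j) = p (v j) * B (part' j) * (B (part j))⁻¹ := by
  have h : ∏ a, B a ^ (-(M a)).toAddMonoidHom (v j)
      = (∏ a, if part' j = a then B a else 1) * ∏ a, if part j = a then (B a)⁻¹ else 1 := by
    rw [← prod_mul_distrib]
    refine prod_congr rfl fun a _ => ?_
    have : (-(M a)).toAddMonoidHom (v j)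
      = (if part' j = a then 1 else 0) - if part j = a then 1 else 0 := by
      simp [hM]
    rw [this]
    split_ifs <;> simp [hB]
  rw [twist, h, Fintype.prod_ite_eq, Fintype.prod_ite_eq, mul_assoc]

/-- The twist multiplies `p (v j)` by `B (part' j) / B (part j)`, so this is the Laplace equation
divided by `B a`. It explains the choice of Laplacian. -/
theorem sum_twist_ray (hr : IsRoot part part' root) (hB : ∀ a, B a ≠ 0)
    (hM : ∀ a j, M a (v j) = (if part j = a then 1 else 0) - if part' j = a then 1 else 0)
    (hlap : ∀ a, root a ≠ a → lapl part part' (fun j => p (v j)) B a = 0) (a : J) :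
    ∑ j with part j = a, twist p M B (v j) = ∑ j with part' j = a, p (v j) := by
  have h := lapl_eq_zero hr hlap a
  rw [lapl, sub_eq_zero, smul_eq_mul] at h
  rw [← mul_inv_cancel_right₀ (hB a) (∑ j with part' j = a, p (v j)), h, sum_mul]
  refine sum_congr rfl fun j hj => ?_
  rw [twist_ray hB hM, (mem_filter.1 hj).2, smul_eq_mul]

end field

variable {m : ℕ} {p : Latt n → FunField m} {t : Latt n → ℝ}

/-- Invertibility over the function field is detected at one point with positive real weights, and
the positive value of the stationary vector there shows that no `B a` vanishes. -/
theorem exists_isUnit_det_lapMat (hr : IsRoot part part' root) {x : ι → FunField m} {y : ι → ℝ}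
    (hx : ∀ j, 0 < y j ∧ (x j, y j) ∈ valRing m) :
    IsUnit (lapMat part part' root x).det ∧ ∃ (B : J → FunField m) (β : J → ℝ),
      (∀ a, root a = a → B a = 1) ∧
      (∀ a, root a ≠ a → lapl part part' x B a = 0) ∧ ∀ a, 0 < β a ∧ (B a, β a) ∈ valRing m := by
  -- Over this subring a single determinant maps to both the function field and `ℝ`, and a nonzero
  -- real component suffices for it to be a unit.
  let X : ι → valRing m := fun j => ⟨(x j, y j), (hx j).2⟩
  let f : valRing m →+* FunField m := (RingHom.fst _ _).comp (valRing m).subtype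
  let g : valRing m →+* ℝ := (RingHom.snd _ _).comp (valRing m).subtype
  have hdetf := f.map_det (lapMat part part' root X)
  have hdetg := g.map_det (lapMat part part' root X)
  rw [RingHom.mapMatrix_apply, lapMat_map] at hdetf hdetg
  have hne : g (lapMat part part' root X).det ≠ 0 := by
    rw [hdetg]
    exact det_lapMat_ne_zero hr fun j => (hx j).1
  have hfne := ne_zero_of_mem_valRing (lapMat part part' root X).det.2 hne
  have hunit : IsUnit (lapMat part part' root X).det := by
    refine IsUnit.of_mul_eq_one
      (⟨_, inv_mem_valRing (lapMat part part' root X).det.2 hne⟩ : valRing m) ?_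
    ext
    · exact mul_inv_cancel₀ hfne
    · exact mul_inv_cancel₀ hne
  obtain ⟨B, hB1, hB⟩ := exists_stationary hunit
  refine ⟨?_, fun a => f (B a), fun a => g (B a), fun a ha => (congrArg f (hB1 a ha)).trans f.map_one,
    fun a ha => ?_, fun a => ⟨?_, (B a).2⟩⟩
  · have := hunit.map f
    rwa [hdetf] at this
  · have := map_lapl f X B a (part := part) (part' := part')
    rw [hB a ha, map_zero] at this
    exact this.symm
  · refine stationary_pos hr (fun j => (hx j).1) (B := fun a => g (B a))
      (fun a ha => by rw [hB1 a ha, map_one]) (fun a ha => ?_) a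
    have := map_lapl g X B a (part := part) (part' := part')
    rw [hB a ha, map_zero] at this
    exact this.symm

/-- Birationality of the twist. Since `y j * B (part j) = p (v j) * B (part' j)`, the same `B` is
stationary for the reversed digraph with the twisted weights `y`. Solving that system inside `E`
recovers `B`, and then `p`. -/
theorem mem_of_twist_mem (hr : IsRoot part part' root)
    (ht : ∀ w, 0 < t w ∧ (p w, t w) ∈ valRing m)
    (hM : ∀ a j, M a (v j) = (if part j = a then 1 else 0) - if part' j = a then 1 else 0)
    {B : J → FunField m} {β : J → ℝ} (hB1 : ∀ a, root a = a → B a = 1)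
    (hlap : ∀ a, root a ≠ a → lapl part part' (fun j => p (v j)) B a = 0)
    (hβ : ∀ a, 0 < β a ∧ (B a, β a) ∈ valRing m)
    {E : IntermediateField ℂ (FunField m)} (hE : ∀ w, twist p M B w ∈ E) (w : Latt n) :
    p w ∈ E := by
  have hB : ∀ a, B a ≠ 0 := fun a => ne_zero_of_mem_valRing (hβ a).2 (hβ a).1.ne'
  set y : ι → FunField m := fun j => twist p M B (v j) with hy
  have hyval : ∀ j, 0 < t (v j) * β (part' j) * (β (part j))⁻¹ ∧
      (y j, t (v j) * β (part' j) * (β (part j))⁻¹) ∈ valRing m := fun j => by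
    refine ⟨mul_pos (mul_pos (ht _).1 (hβ _).1) (inv_pos.2 (hβ _).1), ?_⟩
    rw [hy]
    simp only [twist_ray hB hM]
    exact mul_mem (mul_mem (ht _).2 (hβ _).2) (inv_mem_valRing (hβ _).2 (hβ _).1.ne')
  obtain ⟨hdet, -⟩ := exists_isUnit_det_lapMat hr.symm hyval
  have hlapB : ∀ a, lapl part' part y B a = 0 := fun a => by
    rw [lapl, sum_twist_ray hr hB hM hlap, sub_eq_zero, smul_eq_mul, sum_mul]
    refine sum_congr rfl fun j hj => ?_
    rw [hy]
    simp only [twist_ray hB hM, smul_eq_mul]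
    rw [inv_mul_cancel_right₀ (hB _), (mem_filter.1 hj).2]
  let yE : ι → E := fun j => ⟨y j, hE _⟩
  have hdetE := (algebraMap E (FunField m)).map_det (lapMat part' part root yE)
  rw [RingHom.mapMatrix_apply, lapMat_map] at hdetE
  have hunit : IsUnit (lapMat part' part root yE).det := by
    rw [isUnit_iff_ne_zero]
    intro h
    rw [h, map_zero] at hdetE
    exact hdet.ne_zero hdetE.symm
  obtain ⟨BE, hBE1, hBE⟩ := exists_stationary hunit
  have hBmem : ∀ a, B a ∈ E := fun a => by
    have h := eq_zero_of_lapl_eq_zero hdet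
      (z := (fun a => (algebraMap E (FunField m) (BE a))) - B)
      (fun a ha => by simp [hBE1 a ha, hB1 a ha]) (fun a ha => by
        have := map_lapl (algebraMap E (FunField m)) yE BE a (part := part') (part' := part)
        rw [hBE a ha, map_zero] at this
        rw [lapl_sub, hlapB, sub_zero]
        exact this.symm) a
    rw [Pi.sub_apply, sub_eq_zero] at h
    rw [← h]
    exact (BE a).2
  have hprod : ∏ a, B a ^ (-(M a)).toAddMonoidHom w ≠ 0 :=
    prod_ne_zero_iff.2 fun a _ => zpow_ne_zero _ (hB a)
  rw [← mul_inv_cancel_right₀ hprod (p w)]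
  exact mul_mem (hE w) (inv_mem (prod_mem fun a _ => zpow_mem (hBmem a) _))

end transition

/-! ### Extension of scalars -/

section extension

variable {K : Type*} [Field K] {n : ℕ}

/-- A lattice vector as a vector over `K`. -/
def vec (K : Type*) [Field K] (v : Latt n) : Fin n → K := fun k => (v k : K)

/-- The extension of an element of the dual lattice to vectors over `K`. -/
def dualK (K : Type*) [Field K] (w : DualLatt n) : (Fin n → K) →ₗ[K] K :=
  ∑ k, (w (Pi.single k 1) : K) • LinearMap.proj k

theorem dualK_apply (w : DualLatt n) (x : Fin n → K) :
    dualK K w x = ∑ k, (w (Pi.single k 1) : K) * x k := by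
  simp [dualK]

theorem dualK_vec (w : DualLatt n) (v : Latt n) : dualK K w (vec K v) = (w v : K) := by
  conv_rhs => rw [← Finset.univ_sum_single v]
  rw [dualK_apply, map_sum, Int.cast_sum]
  refine sum_congr rfl fun k _ => ?_
  have : (Pi.single k (v k) : Latt n) = v k • Pi.single k 1 := by
    rw [← Pi.single_smul, smul_eq_mul, mul_one]
  rw [this, map_smul, smul_eq_mul, Int.cast_mul, mul_comm, vec]

theorem vec_single (k : Fin n) : vec K (Pi.single k 1) = Pi.single k 1 := by
  ext i
  simp [vec, Pi.single_apply]

theorem linearMap_ext_vec {V : Type*} [AddCommGroup V] [Module K V] {f g : (Fin n → K) →ₗ[K] V}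
    (h : ∀ v, f (vec K v) = g (vec K v)) : f = g := by
  refine LinearMap.pi_ext' fun k => LinearMap.ext_ring ?_
  have := h (Pi.single k 1)
  rw [vec_single] at this
  exact this

end extension

/-! ### Logarithmic differentials -/

section dlog

set_option linter.unusedSectionVars false

variable {K : Type*} [Field K] [Algebra ℂ K]

/-- The logarithmic differential `d log x`. -/
def dlog (x : K) : Ω[K⁄ℂ] := x⁻¹ • KaehlerDifferential.D ℂ K x

theorem D_eq_smul_dlog {x : K} (hx : x ≠ 0) : KaehlerDifferential.D ℂ K x = x • dlog x := by
  rw [dlog, smul_inv_smul₀ hx]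

theorem dlog_one : dlog (1 : K) = 0 := by simp [dlog]

theorem dlog_mul {x y : K} (hx : x ≠ 0) (hy : y ≠ 0) : dlog (x * y) = dlog x + dlog y := by
  simp only [dlog, Derivation.leibniz, smul_add, smul_smul]
  rw [add_comm]
  congr 2 <;> field_simp

theorem dlog_inv {x : K} (hx : x ≠ 0) : dlog x⁻¹ = -dlog x := by
  have := dlog_mul hx (inv_ne_zero hx)
  rw [mul_inv_cancel₀ hx, dlog_one] at this
  exact (neg_eq_of_add_eq_zero_right this.symm).symm

theorem dlog_zpow {x : K} (hx : x ≠ 0) (k : ℤ) : dlog (x ^ k) = (k : K) • dlog x := by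
  have h : ∀ k : ℕ, dlog (x ^ k) = (k : K) • dlog x := by
    intro k
    induction k with
    | zero => simp [dlog_one]
    | succ k ih =>
      rw [pow_succ, dlog_mul (pow_ne_zero _ hx) hx, ih, Nat.cast_succ, add_smul, one_smul]
  obtain ⟨k, rfl | rfl⟩ := k.eq_nat_or_neg
  · simpa using h k
  · rw [zpow_neg, zpow_natCast, dlog_inv (pow_ne_zero _ hx), h]
    simp

theorem dlog_prod {κ : Type*} {s : Finset κ} {x : κ → K} (hx : ∀ i, x i ≠ 0) :
    dlog (∏ i ∈ s, x i) = ∑ i ∈ s, dlog (x i) := by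
  classical
  induction s using Finset.induction_on with
  | empty => simp [dlog_one]
  | insert a s ha ih =>
    rw [prod_insert ha, sum_insert ha, dlog_mul (hx a) (prod_ne_zero_iff.2 fun i _ => hx i), ih]

variable {n : ℕ}

/-- The `K`-linear extension of `v ↦ d log p(v)`. -/
def dlogMap (p : Latt n → K) : (Fin n → K) →ₗ[K] Ω[K⁄ℂ] :=
  ∑ k, (LinearMap.proj k : (Fin n → K) →ₗ[K] K).smulRight (dlog (p (Pi.single k 1)))

theorem dlogMap_apply (p : Latt n → K) (x : Fin n → K) :
    dlogMap p x = ∑ k, x k • dlog (p (Pi.single k 1)) := by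
  simp [dlogMap]

variable {p : Latt n → K}

theorem dlogMap_vec (hp : IsChar p) (v : Latt n) : dlogMap p (vec K v) = dlog (p v) := by
  rw [hp.apply_eq_prod v, dlog_prod fun k => zpow_ne_zero _ (hp.ne_zero _), dlogMap_apply]
  exact sum_congr rfl fun k _ => (dlog_zpow (hp.ne_zero _) _).symm

theorem dlogMap_smul_vec (hp : IsChar p) (v : Latt n) :
    dlogMap p (p v • vec K v) = KaehlerDifferential.D ℂ K (p v) := by
  rw [map_smul, dlogMap_vec hp, D_eq_smul_dlog (hp.ne_zero v)]

/-- The gradient of the Laurent polynomial `∑ z^{v_j}`, where the sum is over the `j` with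
`part j = a`, at the point `p` of the torus. -/
def gvec {ι J : Type*} [Fintype ι] [DecidableEq J] (part : ι → J) (v : ι → Latt n)
    (p : Latt n → K) (a : J) : Fin n → K :=
  ∑ j with part j = a, p (v j) • vec K (v j)

theorem dlogMap_gvec {ι J : Type*} [Fintype ι] [DecidableEq J] {part : ι → J} {v : ι → Latt n}
    (hp : IsChar p) (a : J) : dlogMap p (gvec part v p a)
      = KaehlerDifferential.D ℂ K (∑ j with part j = a, p (v j)) := by
  rw [gvec, map_sum, map_sum]
  exact sum_congr rfl fun j _ => dlogMap_smul_vec hp _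

end dlog

/-! ### The Jacobian of the change of nef partition -/

section jacobian

set_option linter.unusedSectionVars false

variable {K : Type*} [Field K] [Algebra ℂ K] {n : ℕ} {ι J : Type*} [Fintype ι] [Fintype J]
  [DecidableEq J] {part part' : ι → J} {root : J → J} {v : ι → Latt n} {M : J → DualLatt n}
  {p : Latt n → K} {B : J → K}

theorem map_lapl_linear {R V V' : Type*} [CommRing R] [AddCommGroup V] [Module R V]
    [AddCommGroup V'] [Module R V'] (f : V →ₗ[R] V') (x : ι → R) (z : J → V) (a : J) :
    f (lapl part part' x z a) = lapl part part' x (fun b => f (z b)) a := by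
  simp [lapl, map_sum]

theorem sum_nonroot {V : Type*} [AddCommGroup V] {z : J → V} (hz : ∀ a, root a = a → z a = 0) :
    ∑ a : {a // root a ≠ a}, z a.1 = ∑ a, z a := by
  rw [← Finset.sum_subtype {a | root a ≠ a} (by simp) z]
  exact sum_filter_of_ne fun a _ h hra => h (hz a hra)

/-- The right-hand side of the linear system for the logarithmic derivatives of the `B_a`. -/
def gradRhs (part part' : ι → J) (v : ι → Latt n) (p : Latt n → K) (B : J → K) (a : J) :
    Fin n → K :=
  ∑ j with part j = a, (p (v j) * B (part' j)) • vec K (v j) - B a • gvec part' v p a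

/-- The universal gradient of the vector `B`. -/
theorem exists_gradient (hr : IsRoot part part' root)
    (hdet : IsUnit (lapMat part part' root fun j => p (v j)).det) :
    ∃ κ : J → Fin n → K, (∀ a, root a = a → κ a = 0) ∧
      ∀ a, lapl part part' (fun j => p (v j)) κ a = gradRhs part part' v p B a := by
  obtain ⟨κ, hκ0, hκ⟩ := exists_lapl_eq hdet (gradRhs part part' v p B)
  refine ⟨κ, hκ0, fun a => sub_eq_zero.1 ?_⟩
  -- The system is solved off the roots; both sides sum to zero over each component, so the
  -- equations at the roots follow.
  refine eq_zero_of_sum_class (root := root)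
    (w := fun a => lapl part part' (fun j => p (v j)) κ a - gradRhs part part' v p B a)
    (fun a ha => sub_eq_zero.2 (hκ a ha)) (fun r => ?_) a
  have h : ∀ a, B a • gvec part' v p a
      = ∑ j with part' j = a, (p (v j) * B (part' j)) • vec K (v j) := fun a => by
    rw [gvec, smul_sum]
    refine sum_congr rfl fun j hj => ?_
    rw [(mem_filter.1 hj).2, smul_smul, mul_comm]
  simp only [sum_sub_distrib, sum_class_lapl hr, gradRhs, h, sum_class_sum, hr.root_eq, sub_self]

/-- This is the derivative of the Laplace equation for `B`, with the terms in `D B` moved to one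
side. -/
theorem dlogMap_gradRhs (hp : IsChar p) (a : J)
    (hlap : lapl part part' (fun j => p (v j)) B a = 0) :
    dlogMap p (gradRhs part part' v p B a)
      = lapl part part' (fun j => p (v j)) (fun b => KaehlerDifferential.D ℂ K (B b)) a := by
  have h := congrArg (KaehlerDifferential.D ℂ K) hlap
  simp only [lapl, smul_eq_mul, map_sub, map_sum, map_zero, Derivation.leibniz,
    sum_add_distrib] at h
  rw [gradRhs, map_sub, map_smul, dlogMap_gvec hp, map_sum, lapl]
  have h1 : ∀ j, dlogMap p ((p (v j) * B (part' j)) • vec K (v j))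
      = B (part' j) • KaehlerDifferential.D ℂ K (p (v j)) := fun j => by
    rw [mul_comm, mul_smul, map_smul, dlogMap_smul_vec hp]
  simp only [h1, map_sum]
  rw [← sub_eq_zero, ← neg_eq_zero, ← h]
  abel

/-- Uniqueness for the Laplacian identifies `κ` as a lift of `D B` to `K^n`. The lift is needed
because the differentials `dlog p(e_k)` may be dependent on the locus, while the determinant is
taken in all `n` coordinates. -/
theorem dlogMap_gradient (hp : IsChar p)
    (hdet : IsUnit (lapMat part part' root fun j => p (v j)).det)
    (hB1 : ∀ a, root a = a → B a = 1)
    (hlap : ∀ a, root a ≠ a → lapl part part' (fun j => p (v j)) B a = 0) {κ : J → Fin n → K}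
    (hκ0 : ∀ a, root a = a → κ a = 0)
    (hκ : ∀ a, lapl part part' (fun j => p (v j)) κ a = gradRhs part part' v p B a) (a : J) :
    dlogMap p (κ a) = KaehlerDifferential.D ℂ K (B a) := by
  rw [← sub_eq_zero]
  refine eq_zero_of_lapl_eq_zero hdet
    (z := (fun a => dlogMap p (κ a)) - fun a => KaehlerDifferential.D ℂ K (B a))
    (fun a ha => by simp [hκ0 a ha, hB1 a ha]) (fun a ha => ?_) a
  rw [lapl_sub, ← map_lapl_linear, hκ, dlogMap_gradRhs hp a (hlap a ha), sub_self]

/-- The Jacobian matrix of the twist, in logarithmic coordinates. -/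
def jacMat (root : J → J) (M : J → DualLatt n) (B : J → K) (κ : J → Fin n → K) :
    Matrix (Fin n) (Fin n) K :=
  1 - (Matrix.of fun k (a : {a // root a ≠ a}) => (B a.1)⁻¹ * κ a.1 k) *
    Matrix.of fun (a : {a // root a ≠ a}) k => (M a.1 (Pi.single k 1) : K)

theorem jacMat_mulVec {κ : J → Fin n → K} (hκ0 : ∀ a, root a = a → κ a = 0) (x : Fin n → K) :
    (jacMat root M B κ).mulVec x = x - ∑ a, (dualK K (M a) x * (B a)⁻¹) • κ a := by
  rw [jacMat, Matrix.sub_mulVec, Matrix.one_mulVec, ← Matrix.mulVec_mulVec,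
    ← sum_nonroot (root := root) fun a ha => by rw [hκ0 a ha, smul_zero]]
  congr 1
  ext k
  simp only [Matrix.mulVec, dotProduct, Matrix.of_apply, Finset.sum_apply, Pi.smul_apply,
    smul_eq_mul, dualK_apply]
  exact sum_congr rfl fun a _ => by ring

theorem dlogMap_twist (hp : IsChar p) (hB : ∀ a, B a ≠ 0) {κ : J → Fin n → K}
    (hκ0 : ∀ a, root a = a → κ a = 0)
    (hκ : ∀ a, dlogMap p (κ a) = KaehlerDifferential.D ℂ K (B a)) (x : Fin n → K) :
    dlogMap (twist p M B) x = dlogMap p ((jacMat root M B κ).mulVec x) := by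
  have : dlogMap (twist p M B) = (dlogMap p).comp (jacMat root M B κ).mulVecLin := by
    refine linearMap_ext_vec fun w => ?_
    rw [dlogMap_vec (isChar_twist hp hB), LinearMap.comp_apply, Matrix.mulVecLin_apply,
      jacMat_mulVec hκ0, map_sub, dlogMap_vec hp, twist, dlog_mul (hp.ne_zero w)
      (prod_ne_zero_iff.2 fun a _ => zpow_ne_zero _ (hB a)),
      dlog_prod fun a => zpow_ne_zero _ (hB a), map_sum, sub_eq_add_neg, ← sum_neg_distrib]
    congr 1
    refine sum_congr rfl fun a _ => ?_
    rw [dlog_zpow (hB a), map_smul, hκ, dualK_vec, mul_smul, dlog]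
    simp
  rw [this]
  rfl

/-- The differential of the identity `G_a(p) = G'_a(p')`, valid already for the lifted gradients in
`K^n`. The terms in `κ a` cancel by the Laplace equation for `B`, and the equation for `κ` does the
rest. -/
theorem jacMat_mulVec_gvec (hr : IsRoot part part' root) (hB : ∀ a, B a ≠ 0)
    (hM : ∀ a j, M a (v j) = (if part j = a then 1 else 0) - if part' j = a then 1 else 0)
    (hlap : ∀ a, root a ≠ a → lapl part part' (fun j => p (v j)) B a = 0) {κ : J → Fin n → K}
    (hκ0 : ∀ a, root a = a → κ a = 0)
    (hκ : ∀ a, lapl part part' (fun j => p (v j)) κ a = gradRhs part part' v p B a) (a : J) :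
    (jacMat root M B κ).mulVec (gvec part v (twist p M B) a) = gvec part' v p a := by
  have hray : ∀ j, (jacMat root M B κ).mulVec (vec K (v j))
      = vec K (v j) - (B (part j))⁻¹ • κ (part j) + (B (part' j))⁻¹ • κ (part' j) := fun j => by
    rw [jacMat_mulVec hκ0]
    simp only [dualK_vec, hM, Int.cast_sub, Int.cast_ite, Int.cast_one, Int.cast_zero, sub_mul,
      sub_smul, sum_sub_distrib, ite_mul, one_mul, zero_mul, ite_smul, zero_smul,
      Fintype.sum_ite_eq]
    abel
  have h1 := lapl_eq_zero hr hlap a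
  have h2 := hκ a
  rw [lapl, sub_eq_zero] at h1
  rw [lapl, gradRhs] at h2
  have h3 : B a • (jacMat root M B κ).mulVec (gvec part v (twist p M B) a)
      = ∑ j with part j = a, (p (v j) * B (part' j)) • vec K (v j)
        - (∑ j with part j = a, p (v j) * B (part' j)) • (B a)⁻¹ • κ a
        + ∑ j with part j = a, p (v j) • κ (part' j) := by
    rw [gvec, ← Matrix.mulVecLin_apply, map_sum, smul_sum, sum_smul, ← sum_sub_distrib,
      ← sum_add_distrib]
    refine sum_congr rfl fun j hj => ?_
    rw [map_smul, Matrix.mulVecLin_apply, hray, twist_ray hB hM, (mem_filter.1 hj).2, smul_smul,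
      smul_add, smul_sub, smul_smul _ _ (κ (part' j))]
    have e1 : B a * (p (v j) * B (part' j) * (B a)⁻¹) = p (v j) * B (part' j) := by
      field_simp [hB a]
    rw [e1, mul_inv_cancel_right₀ (hB _)]
  simp only [smul_eq_mul] at h1
  rw [← h1, smul_smul, mul_inv_cancel_right₀ (hB a)] at h3
  refine smul_right_injective _ (hB a) ?_
  simp only
  rw [h3, ← sub_eq_zero, sub_eq_iff_eq_add.1 h2]
  abel

/-- The identity `det (1 - XY) = det (1 - YX)` moves the determinant to the non-roots, where the
matrix is `Qᵀ diag(B)⁻¹`. Pairing the equations for `κ` with the `M i` gives `Λ Q = -diag(B) Λᵀ`;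
the determinants of `Λ` and of `diag(B)` cancel, leaving the sign. -/
theorem det_jacMat (hr : IsRoot part part' root) (hB : ∀ a, B a ≠ 0)
    (hM : ∀ a j, M a (v j) = (if part j = a then 1 else 0) - if part' j = a then 1 else 0)
    (hdet : IsUnit (lapMat part part' root fun j => p (v j)).det)
    (hlap : ∀ a, root a ≠ a → lapl part part' (fun j => p (v j)) B a = 0) {κ : J → Fin n → K}
    (hκ0 : ∀ a, root a = a → κ a = 0)
    (hκ : ∀ a, lapl part part' (fun j => p (v j)) κ a = gradRhs part part' v p B a) :
    (jacMat root M B κ).det = (-1) ^ Fintype.card {a // root a ≠ a} := by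
  set Λ := lapMat part part' root fun j => p (v j) with hΛ
  let Q : Matrix {a // root a ≠ a} {a // root a ≠ a} K :=
    Matrix.of fun b i => (if b.1 = i.1 then B b.1 else 0) - dualK K (M i.1) (κ b.1)
  have hmul : Λ * Q = -(Matrix.diagonal (fun a : {a // root a ≠ a} => B a.1) * Λ.transpose) := by
    ext a i
    rw [Matrix.mul_apply]
    have h1 := sum_lapMat_smul (part := part) (part' := part') (x := fun j => p (v j))
      (z := (fun b => if b = i.1 then B b else 0) - fun b => dualK K (M i.1) (κ b))
      (fun b hb => by
        have : b ≠ i.1 := fun h => i.2 (h ▸ hb)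
        simp [hκ0 b hb, this]) a
    refine h1.trans ?_
    rw [lapl_sub, ← map_lapl_linear, hκ, gradRhs, map_sub, map_smul, gvec, map_sum, map_sum]
    have h2 := lapl_eq_zero hr hlap a.1
    rw [lapl, sub_eq_zero] at h2
    simp only [map_smul, dualK_vec, hM, Int.cast_sub, Int.cast_ite, Int.cast_one, Int.cast_zero,
      lapl, smul_eq_mul, Matrix.neg_apply, Matrix.diagonal_mul, Matrix.transpose_apply, hΛ, lapMat,
      Matrix.of_apply, mul_sub, sum_sub_distrib, mul_ite, mul_one, mul_zero, Subtype.ext_iff] at h2 ⊢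
    simp only [← sum_filter, filter_filter]
    have hcomm : ({j | part' j = a.1 ∧ part j = i.1} : Finset ι)
        = ({j | part j = i.1 ∧ part' j = a.1} : Finset ι) := by
      ext j
      simp [and_comm]
    rw [hcomm]
    by_cases hai : a.1 = i.1
    · simp only [hai, and_self, if_true] at h2 ⊢
      rw [← h2]
      ring
    · have hemp : ∀ f : ι → J, ({j | f j = a.1 ∧ f j = i.1} : Finset ι) = ∅ := fun f =>
        filter_eq_empty_iff.2 fun j _ h => hai (h.1.symm.trans h.2)
      rw [if_neg hai, if_neg (Ne.symm hai), hemp, hemp, sum_empty, sum_empty]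
      ring
  have hprod : ∏ a : {a // root a ≠ a}, B a.1 ≠ 0 := prod_ne_zero_iff.2 fun a _ => hB _
  have hQ : Q.det = (-1) ^ Fintype.card {a // root a ≠ a} * ∏ a : {a // root a ≠ a}, B a.1 := by
    have := congrArg Matrix.det hmul
    rw [Matrix.det_mul, Matrix.det_neg, Matrix.det_mul, Matrix.det_transpose,
      Matrix.det_diagonal] at this
    refine mul_left_cancel₀ hdet.ne_zero (this.trans ?_)
    ring
  rw [jacMat, Matrix.det_one_sub_mul_comm]
  have heq : (1 - (Matrix.of fun (a : {a // root a ≠ a}) k => (M a.1 (Pi.single k 1) : K)) *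
      (Matrix.of fun k (a : {a // root a ≠ a}) => (B a.1)⁻¹ * κ a.1 k))
      = Q.transpose * Matrix.diagonal fun a : {a // root a ≠ a} => (B a.1)⁻¹ := by
    ext a b
    rw [Matrix.mul_diagonal, Matrix.sub_apply, Matrix.mul_apply, Matrix.transpose_apply]
    simp only [Q, Matrix.of_apply, dualK_apply, sub_mul, ite_mul, zero_mul, Matrix.one_apply,
      mul_inv_cancel₀ (hB _), sum_mul, Subtype.ext_iff, eq_comm]
    congr 1
    exact sum_congr rfl fun k _ => by ring
  rw [heq, Matrix.det_mul, Matrix.det_transpose, Matrix.det_diagonal, hQ, prod_inv_distrib,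
    mul_inv_cancel_right₀ hprod]

end jacobian

/-! ### Comparison of volume forms -/

theorem alternatingMap_sum_smul {K V W : Type*} [Field K] [AddCommGroup V] [Module K V]
    [AddCommGroup W] [Module K W] {m : ℕ} (f : V [⋀^Fin m]→ₗ[K] W) (y : Fin m → V)
    (a : Matrix (Fin m) (Fin m) K) :
    f (fun k => ∑ j, a j k • y j) = a.det • f y := by
  let b := Pi.basisFun K (Fin m)
  let g := f.compLinearMap (b.constr K y)
  let h := (LinearMap.toSpanSingleton K W (f y)).compAlternatingMap b.det
  have hgh : g = h := by
    refine Module.Basis.ext_alternating b fun σ hσ => ?_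
    let σ' := Equiv.ofBijective σ (Finite.injective_iff_bijective.1 hσ)
    have h1 : g (fun i => b (σ i)) = f (y ∘ σ') := by
      simp only [g, AlternatingMap.compLinearMap_apply, Module.Basis.constr_basis]
      rfl
    have h2 : h (fun i => b (σ i)) = b.det (b ∘ σ') • f y := rfl
    rw [h1, h2, f.map_perm, AlternatingMap.map_perm, Module.Basis.det_self, Units.smul_def,
      Units.smul_def, zsmul_one, Int.cast_smul_eq_zsmul]
  have h3 := congrArg (fun F => F fun k j => a j k) hgh
  simp only [g, h, AlternatingMap.compLinearMap_apply, LinearMap.compAlternatingMap_apply,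
    LinearMap.toSpanSingleton_apply] at h3
  have h4 : b.det (fun k j => a j k) = a.det := by
    rw [Pi.basisFun_det_apply, ← Matrix.det_transpose]
    rfl
  rw [h4] at h3
  rw [← h3]
  congr 1
  ext k
  rw [Module.Basis.constr_apply_fintype]
  simp [b]

section volume

variable {n m c : ℕ} {u : Fin c → DualLatt n} {q : Latt n →+ Latt m} {l : Latt m →+ Latt n}
  {b : Fin c → Latt n}

/-- The matrix of `(u, q) : N → ℤ^c × ℤ^m`. -/
def splitMat (u : Fin c → DualLatt n) (q : Latt n →+ Latt m) : Matrix (Fin c ⊕ Fin m) (Fin n) ℤ :=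
  Matrix.of fun i k => Sum.elim (fun i => u i (Pi.single k 1)) (fun j => q (Pi.single k 1) j) i

/-- The matrix of `(b, l) : ℤ^c × ℤ^m → N`. -/
def splitInv (l : Latt m →+ Latt n) (b : Fin c → Latt n) : Matrix (Fin n) (Fin c ⊕ Fin m) ℤ :=
  Matrix.of fun k i => Sum.elim (fun i => b i k) (fun j => l (Pi.single j 1) k) i

theorem splitMat_mulVec (v : Latt n) (i : Fin c ⊕ Fin m) :
    (splitMat u q).mulVec v i = Sum.elim (fun i => u i v) (fun j => q v j) i := by
  have hv : v = ∑ k, v k • (Pi.single k 1 : Latt n) := by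
    conv_lhs => rw [← Finset.univ_sum_single v]
    exact sum_congr rfl fun k _ => by rw [← Pi.single_smul, smul_eq_mul, mul_one]
  rcases i with i | j
  · conv_rhs => rw [hv]
    simp only [splitMat, Matrix.mulVec, dotProduct, Matrix.of_apply, Sum.elim_inl, map_sum]
    exact sum_congr rfl fun k _ => by rw [map_smul, smul_eq_mul, mul_comm]
  · conv_rhs => rw [hv]
    simp only [splitMat, Matrix.mulVec, dotProduct, Matrix.of_apply, Sum.elim_inr, map_sum,
      Finset.sum_apply]
    exact sum_congr rfl fun k _ => by rw [map_zsmul, Pi.smul_apply, smul_eq_mul, mul_comm]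

theorem splitMat_mul_splitInv (h : IsSplitting u q l b) : splitMat u q * splitInv l b = 1 := by
  ext i j
  have : (splitMat u q * splitInv l b) i j
      = (splitMat u q).mulVec (fun k => splitInv l b k j) i := rfl
  rw [this]
  rcases j with j | j
  · refine (splitMat_mulVec (b j) i).trans ?_
    rcases i with i | i <;> simp [h.u_b, h.q_b, Matrix.one_apply]
  · refine (splitMat_mulVec (l (Pi.single j 1)) i).trans ?_
    rcases i with i | i <;> simp [h.u_l, h.q_l, Matrix.one_apply, Pi.single_apply]

theorem splitInv_mul_splitMat (h : IsSplitting u q l b) : splitInv l b * splitMat u q = 1 := by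
  ext k k'
  have hv := congrFun (h.eq_add (Pi.single k' 1)) k
  have hl : ∀ w : Latt m, l w k = ∑ j, w j * l (Pi.single j 1) k := fun w => by
    conv_lhs => rw [← Finset.univ_sum_single w]
    rw [map_sum, Finset.sum_apply]
    refine sum_congr rfl fun j _ => ?_
    have : (Pi.single j (w j) : Latt m) = w j • Pi.single j 1 := by
      rw [← Pi.single_smul, smul_eq_mul, mul_one]
    rw [this, map_zsmul, Pi.smul_apply, smul_eq_mul]
  rw [Pi.add_apply, hl, Finset.sum_apply] at hv
  rw [Matrix.mul_apply, Fintype.sum_sum_type, Matrix.one_apply, ← Pi.single_apply, hv, add_comm]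
  congr 1 <;> exact sum_congr rfl fun i _ => mul_comm _ _

variable {u' : Fin c → DualLatt n} {q' : Latt n →+ Latt m} {l' : Latt m →+ Latt n}
  {b' : Fin c → Latt n}

theorem det_splitMat_mul_splitInv (h : IsSplitting u q l b) (h' : IsSplitting u' q' l' b') :
    (splitMat u' q' * splitInv l b).det = 1 ∨ (splitMat u' q' * splitInv l b).det = -1 := by
  rw [← Int.isUnit_iff]
  refine IsUnit.of_mul_eq_one (splitMat u q * splitInv l' b').det ?_
  rw [← Matrix.det_mul, Matrix.mul_assoc, ← Matrix.mul_assoc (splitInv l b),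
    splitInv_mul_splitMat h, Matrix.one_mul, splitMat_mul_splitInv h', Matrix.det_one]

variable {K : Type*} [Field K] {ι : Type*} [Fintype ι] {v : ι → Latt n}

/-- The matrix whose columns are the gradients of the `G_i` and the vectors `l(e_j)`. -/
def frame (part : ι → Fin (c + 1)) (v : ι → Latt n) (l : Latt m →+ Latt n) (p : Latt n → K) :
    Matrix (Fin n) (Fin c ⊕ Fin m) K :=
  Matrix.of fun k i => Sum.elim (fun i => gvec part v p (Fin.castSucc i) k)
    (fun j => vec K (l (Pi.single j 1)) k) i

/-- In the coordinates `(u, q)` the chart directions become `(0, 1)`, so only the pairings of the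
`u_i` with the gradients matter. Those are triangular, with diagonal `-G_i = -1`. -/
theorem det_splitMat_mul_frame (h : IsSplitting u q l b) {part : ι → Fin (c + 1)}
    (h1 : ∀ i j, part j = Fin.castSucc i → u i (v j) = -1)
    (h0 : ∀ i j, part j < Fin.castSucc i → u i (v j) = 0) {p : Latt n → K}
    (hG : ∀ i : Fin c, ∑ j with part j = i.castSucc, p (v j) = 1) :
    ((splitMat u q).map (Int.castRingHom K) * frame part v l p).det = (-1) ^ c := by
  let U : Matrix (Fin c) (Fin c) K :=
    Matrix.of fun i j => dualK K (u i) (gvec part v p (Fin.castSucc j))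
  have hcol : ∀ w : Latt n, ((splitMat u q).map (Int.castRingHom K)).mulVec (vec K w)
      = fun i => ((splitMat u q).mulVec w i : K) := fun w => by
    ext i
    simp [Matrix.mulVec, dotProduct, vec]
  have hblock : (splitMat u q).map (Int.castRingHom K) * frame part v l p
      = Matrix.fromBlocks U 0 (Matrix.of fun i j =>
        ((splitMat u q).map (Int.castRingHom K) * frame part v l p) (Sum.inr i) (Sum.inl j)) 1 := by
    ext i j
    rcases i with i | i <;> rcases j with j | j
    · rw [Matrix.fromBlocks_apply₁₁, Matrix.mul_apply]
      simp [U, dualK_apply, splitMat, frame]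
    · have := congrFun (hcol (l (Pi.single j 1))) (Sum.inl i)
      rw [splitMat_mulVec, Sum.elim_inl, h.u_l, Int.cast_zero] at this
      exact this
    · rfl
    · have := congrFun (hcol (l (Pi.single j 1))) (Sum.inr i)
      rw [splitMat_mulVec, Sum.elim_inr, h.q_l] at this
      refine this.trans ?_
      rw [Matrix.fromBlocks_apply₂₂, Matrix.one_apply, Pi.single_apply]
      split_ifs <;> simp
  have hU : ∀ i j, U i j = ∑ k with part k = Fin.castSucc j, p (v k) * (u i (v k) : K) :=
    fun i j => by
      simp [U, gvec, map_sum, dualK_vec]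
  rw [hblock, Matrix.det_fromBlocks_zero₁₂, Matrix.det_one, mul_one,
    Matrix.det_of_isUpperTriangular]
  · have hdiag : ∀ i, U i i = -1 := fun i => by
      rw [hU, ← hG i, ← sum_neg_distrib]
      refine sum_congr rfl fun k hk => ?_
      rw [h1 i k (mem_filter.1 hk).2]
      simp
    simp [hdiag]
  · intro i j hij
    refine (hU i j).trans (sum_eq_zero fun k hk => ?_)
    rw [h0 i k (by rw [(mem_filter.1 hk).2]; simpa using hij)]
    simp

end volume

/-- A residue computation: `A` has determinant `±1` and matches the gradients normal to the two
loci, so the block it induces on the chart directions modulo gradients also has determinant `±1`. -/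
theorem isVolumePreserving_of_jacobian {n m c : ℕ} {u u' : Fin c → DualLatt n}
    {q q' : Latt n →+ Latt m} {l l' : Latt m →+ Latt n} {b b' : Fin c → Latt n}
    (h : IsSplitting u q l b) (h' : IsSplitting u' q' l' b') {ι : Type*} [Fintype ι]
    {v : ι → Latt n} {part part' : ι → Fin (c + 1)}
    (h1 : ∀ i j, part j = Fin.castSucc i → u i (v j) = -1)
    (h0 : ∀ i j, part j < Fin.castSucc i → u i (v j) = 0)
    (h1' : ∀ i j, part' j = Fin.castSucc i → u' i (v j) = -1)
    (h0' : ∀ i j, part' j < Fin.castSucc i → u' i (v j) = 0)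
    {p p' : Latt n → FunField m} (hp : IsChar p) (hp' : IsChar p')
    (hG : ∀ i : Fin c, ∑ j with part j = i.castSucc, p (v j) = 1)
    (hG' : ∀ i : Fin c, ∑ j with part' j = i.castSucc, p' (v j) = 1)
    (hl' : ∀ w, p' (l' w) = toFun (mono w)) {A : Matrix (Fin n) (Fin n) (FunField m)}
    (hA : A.det = 1 ∨ A.det = -1) (hAp : ∀ x, dlogMap p x = dlogMap p' (A.mulVec x))
    (hAg : ∀ a, A.mulVec (gvec part v p a) = gvec part' v p' a) {φ : BirMap m}
    (hφ : ∀ i, φ (coord m i) = p (l (Pi.single i 1))) : IsVolumePreserving φ := by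
  let cast := Int.castRingHom (FunField m)
  let S := (splitMat u q).map cast
  let S' := (splitMat u' q').map cast
  let R := (splitInv l b).map cast
  let R' := (splitInv l' b').map cast
  have hSR : S * R = 1 := by
    rw [← Matrix.map_mul, splitMat_mul_splitInv h, Matrix.map_one _ (map_zero _) (map_one _)]
  have hRS : R * S = 1 := by
    rw [← Matrix.map_mul, splitInv_mul_splitMat h, Matrix.map_one _ (map_zero _) (map_one _)]
  have hRS' : R' * S' = 1 := by
    rw [← Matrix.map_mul, splitInv_mul_splitMat h', Matrix.map_one _ (map_zero _) (map_one _)]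
  have hε : (S' * R).det = 1 ∨ (S' * R).det = -1 := by
    have : (S' * R).det = cast (splitMat u' q' * splitInv l b).det := by
      rw [← Matrix.map_mul, RingHom.map_det]
      rfl
    rw [this]
    rcases det_splitMat_mul_splitInv h h' with e | e
    · left; rw [e, map_one]
    · right; rw [e, map_neg, map_one]
  set Γ := frame part v l p with hΓ
  set Γ' := frame part' v l' p' with hΓ'
  have hd : (S * Γ).det = (-1) ^ c := det_splitMat_mul_frame h h1 h0 hG
  have hd' : (S' * Γ').det = (-1) ^ c := det_splitMat_mul_frame h' h1' h0' hG'
  have hunit : IsUnit (S' * Γ').det := by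
    rw [hd']
    exact isUnit_one.neg.pow _
  let N := (S' * Γ')⁻¹ * S'
  have hNΓ : N * Γ' = 1 := by
    rw [Matrix.mul_assoc, Matrix.nonsing_inv_mul _ hunit]
  have hΓN : Γ' * N = 1 := by
    calc Γ' * N = (R' * S') * Γ' * ((S' * Γ')⁻¹ * S') := by rw [hRS', Matrix.one_mul]
      _ = R' * ((S' * Γ') * (S' * Γ')⁻¹) * S' := by simp only [Matrix.mul_assoc]
      _ = 1 := by rw [Matrix.mul_nonsing_inv _ hunit, Matrix.mul_one, hRS']
  -- `T` is the matrix of `A` in the two frames; its columns at the gradients are those of the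
  -- identity.
  let T := N * (A * Γ)
  have hT : Γ' * T = A * Γ := by
    rw [← Matrix.mul_assoc, hΓN, Matrix.one_mul]
  have hdetT : T.det = (S' * R).det * A.det := by
    have e1 : S' * Γ' * T = (S' * R) * (S * A * R) * (S * Γ) := by
      calc S' * Γ' * T = S' * (A * Γ) := by rw [Matrix.mul_assoc, hT]
        _ = S' * ((R * S) * A * ((R * S) * Γ)) := by
          rw [hRS, Matrix.one_mul, Matrix.one_mul]
        _ = _ := by simp only [Matrix.mul_assoc]
    have e2 := congrArg Matrix.det e1
    rw [Matrix.det_mul, Matrix.det_mul, Matrix.det_mul (S' * R), hd, hd',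
      Matrix.det_conj_of_mul_eq_one hSR hRS, mul_comm] at e2
    exact mul_right_cancel₀ (pow_ne_zero c (neg_ne_zero.2 one_ne_zero)) e2
  have hinl : ∀ i j, T i (Sum.inl j) = 
      (1 : Matrix (Fin c ⊕ Fin m) (Fin c ⊕ Fin m) (FunField m)) i (Sum.inl j) := by
    intro i j
    have : (A * Γ).col (Sum.inl j) = Γ'.col (Sum.inl j) := hAg _
    have e : ∀ k, (A * Γ) k (Sum.inl j) = Γ' k (Sum.inl j) := fun k => congrFun this k
    rw [← hNΓ, Matrix.mul_apply]
    refine (Matrix.mul_apply (M := N) (N := A * Γ)).trans ?_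
    exact sum_congr rfl fun k _ => by rw [e k]
  have hblock : T = Matrix.fromBlocks 1 T.toBlocks₁₂ 0 T.toBlocks₂₂ := by
    ext i j
    rcases i with i | i <;> rcases j with j | j
    · rw [hinl]
      simp [Matrix.one_apply]
    · rfl
    · rw [hinl]
      simp
    · rfl
  have hdeta : T.toBlocks₂₂.det = 1 ∨ T.toBlocks₂₂.det = -1 := by
    have e := congrArg Matrix.det hblock
    rw [Matrix.det_fromBlocks_zero₂₁, Matrix.det_one, one_mul, hdetT] at e
    rw [← e]
    rcases hε with e1 | e1 <;> rcases hA with e2 | e2 <;> simp [e1, e2]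
  have hdlog : ∀ k, dlog (φ (coord m k)) = ∑ j, T.toBlocks₂₂ j k • dlog (coord m j) := by
    intro k
    have e : A.mulVec (vec _ (l (Pi.single k 1)))
        = ∑ i, T (Sum.inl i) (Sum.inr k) • gvec part' v p' (Fin.castSucc i)
          + ∑ j, T (Sum.inr j) (Sum.inr k) • vec _ (l' (Pi.single j 1)) := by
      ext r
      have := congrFun₂ hT r (Sum.inr k)
      rw [Matrix.mul_apply, Fintype.sum_sum_type] at this
      refine Eq.trans ?_ (this.symm.trans ?_)
      · rfl
      · simp only [Pi.add_apply, Finset.sum_apply, Pi.smul_apply, smul_eq_mul]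
        congr 1 <;> exact sum_congr rfl fun i _ => mul_comm _ _
    -- The gradient terms drop out because they map to differentials of the constants `G'_i = 1`;
    -- only the lower right block of `T` survives.
    rw [hφ, ← dlogMap_vec hp, hAp, e, map_add, map_sum, map_sum]
    simp only [map_smul, dlogMap_gvec hp', hG', Derivation.map_one_eq_zero, smul_zero,
      sum_const_zero, zero_add, dlogMap_vec hp', hl']
    rfl
  have hform : dlogForm (fun i => φ (coord m i)) = T.toBlocks₂₂.det • dlogForm (coord m) := by
    have e : dlogForm (fun i => φ (coord m i))
        = exteriorPower.ιMulti (FunField m) m fun k => dlog (φ (coord m k)) := rfl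
    rw [e, funext hdlog, alternatingMap_sum_smul]
    rfl
  rcases hdeta with e | e
  · left
    rw [hform, e, one_smul]
  · right
    rw [hform, e]
    exact neg_one_smul (FunField m) (dlogForm (coord m))

/-! ### Mutation equivalence of the mirrors -/

section main

variable {n c : ℕ} {ι : Type*} [DecidableEq ι] [Fintype ι]
  {Y : SmoothCompleteFan n ι} {L : Fin c → Y.Pic}

/-- The rays of a complete fan satisfy a linear relation with positive coefficients. -/
theorem exists_pos_relation (Y : SmoothCompleteFan n ι) :
    ∃ a : ι → ℝ, (∀ j, 0 < a j) ∧ ∑ j, a j • vec ℝ (Y.ray j) = 0 := by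
  -- Completeness puts minus the sum of all rays in some cone; adding the sum back makes every
  -- coefficient at least `1`.
  obtain ⟨σ, -, a, ha, hx⟩ := Y.complete (-∑ j, vec ℝ (Y.ray j))
  refine ⟨fun j => 1 + if j ∈ σ then a j else 0, fun j => ?_, ?_⟩
  · beta_reduce
    split_ifs
    · linarith [ha j]
    · norm_num
  · simp only [add_smul, one_smul, sum_add_distrib, ite_smul, zero_smul, sum_ite_mem, univ_inter]
    rw [add_eq_zero_iff_neg_eq, hx]
    rfl

/-- The parts of two nef partitions for the same line bundles are linearly equivalent. -/
theorem exists_linear_equivalence (P P' : NefPartition Y L) :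
    ∃ M : Fin (c + 1) → DualLatt n, ∀ a j, M a (Y.ray j)
      = (if P.part j = a then 1 else 0) - if P'.part j = a then 1 else 0 := by
  have h : ∀ i : Fin c, ∃ w : DualLatt n, ∀ j, w (Y.ray j)
      = (if P.part j = i.castSucc then 1 else 0) - if P'.part j = i.castSucc then 1 else 0 := by
    intro i
    have e := (P.sum_eq i).trans (P'.sum_eq i).symm
    have hD : ∀ t : Finset ι, ∑ j ∈ t, Y.D j
        = (LinearMap.range Y.rhoStar).mkQ (∑ j ∈ t, Pi.single j 1) := fun t => by
      rw [map_sum]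
      rfl
    rw [hD, hD, Submodule.mkQ_apply, Submodule.mkQ_apply, Submodule.Quotient.eq] at e
    obtain ⟨w, hw⟩ := e
    refine ⟨w, fun j => ?_⟩
    have := congrFun hw j
    simp only [Pi.sub_apply, Finset.sum_apply, Pi.single_apply, sum_ite_eq, mem_filter, mem_univ,
      true_and] at this
    exact this
  choose w hw using h
  refine ⟨Fin.lastCases (-∑ i, w i) w, fun a j => ?_⟩
  beta_reduce
  induction a using Fin.lastCases with
  | cast i => rw [Fin.lastCases_castSucc, hw]
  -- The indicators of all parts sum to `1` for both partitions, so minus the sum of the other `w i`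
  -- handles the last part, which has no prescribed line bundle.
  | last =>
    have hsum : ∀ b : Fin (c + 1), (∑ i : Fin c, if b = i.castSucc then (1 : ℤ) else 0)
        = 1 - if b = Fin.last c then 1 else 0 := fun b => by
      have := Fin.sum_univ_castSucc fun i => if b = i then (1 : ℤ) else 0
      rw [Fintype.sum_ite_eq] at this
      exact eq_sub_of_add_eq this.symm
    rw [Fin.lastCases_last, LinearMap.neg_apply, LinearMap.sum_apply]
    simp only [hw, sum_sub_distrib, hsum]
    ring

/-- Pairing the positive relation among the rays with `M b` says that its coefficients form a
circulation on the digraph. -/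
theorem exists_isRoot_of_nefPartition {P P' : NefPartition Y L} {M : Fin (c + 1) → DualLatt n}
    (hM : ∀ a j, M a (Y.ray j)
      = (if P.part j = a then 1 else 0) - if P'.part j = a then 1 else 0) :
    ∃ root, IsRoot P.part P'.part root := by
  obtain ⟨a, ha, hsum⟩ := exists_pos_relation Y
  refine exists_isRoot ha fun b => ?_
  have h := congrArg (dualK ℝ (M b)) hsum
  rw [map_sum, map_zero] at h
  simp only [map_smul, dualK_vec, hM, smul_eq_mul, Int.cast_sub, Int.cast_ite, Int.cast_one,
    Int.cast_zero, mul_sub, mul_ite, mul_one, mul_zero, sum_sub_distrib] at h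
  rw [sum_filter, sum_filter]
  exact sub_eq_zero.1 h

theorem mutationEquivalent_of_isLaurentMirror {P P' : NefPartition Y L}
    {u u' : Fin c → DualLatt n} {s s' : Fin c → ι} {f f' : Laurent (n - c)}
    (hu : P.IsAmenable u) (hs : ∀ i, s i ∈ P.S i.castSucc) (hf : IsLaurentMirror P u s f)
    (hu' : P'.IsAmenable u') (hs' : ∀ i, s' i ∈ P'.S i.castSucc)
    (hf' : IsLaurentMirror P' u' s' f') : MutationEquivalent f f' := by
  obtain ⟨q, hq, hker, rfl⟩ := hf.exists_eq hu hs
  obtain ⟨q', hq', hker', rfl⟩ := hf'.exists_eq hu' hs'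
  have hqs : ∀ i, q (Y.ray (s i)) = 0 := fun i => by
    rw [← AddMonoidHom.mem_ker, hker]
    exact AddSubgroup.subset_closure ⟨i, rfl⟩
  have hqs' : ∀ i, q' (Y.ray (s' i)) = 0 := fun i => by
    rw [← AddMonoidHom.mem_ker, hker']
    exact AddSubgroup.subset_closure ⟨i, rfl⟩
  obtain ⟨l, b, hl⟩ := exists_isSplitting hu hs hq hker
  obtain ⟨l', b', hl'⟩ := exists_isSplitting hu' hs' hq' hker'
  obtain ⟨p', t, hp', hpl', hG', hW', ht⟩ := exists_generic_point hu' hs' hqs' hl'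
  obtain ⟨M, hM⟩ := exists_linear_equivalence P P'
  obtain ⟨root, hr⟩ := exists_isRoot_of_nefPartition hM
  obtain ⟨hdet, B, β, hB1, hlap, hβ⟩ := exists_isUnit_det_lapMat hr
    (x := fun j => p' (Y.ray j)) (y := fun j => t (Y.ray j)) fun j => ht _
  have hB : ∀ a, B a ≠ 0 := fun a => ne_zero_of_mem_valRing (hβ a).2 (hβ a).1.ne'
  set p := twist p' M B with hpdef
  have hp : IsChar p := isChar_twist hp' hB
  have hsum := sum_twist_ray hr hB hM hlap
  have hG : ∀ i : Fin c, ∑ k ∈ P.S i.castSucc, p (Y.ray k) = 1 := fun i =>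
    (hsum i.castSucc).trans (hG' i)
  have hW : ∑ k, p (Y.ray k) = ∑ k, p' (Y.ray k) := by
    rw [← sum_fiberwise univ P.part, ← sum_fiberwise univ P'.part fun k => p' (Y.ray k)]
    exact sum_congr rfl fun a _ => hsum a
  -- The values of `p` on the first chart generate all of `p`, hence by untwisting all of `p'`,
  -- whose values on the second chart are the coordinate monomials.
  have hgen : IntermediateField.adjoin ℂ (Set.range fun w => p (l w)) = ⊤ := by
    rw [eq_top_iff, ← adjoin_range_mono, IntermediateField.adjoin_le_iff]
    rintro _ ⟨w, rfl⟩
    have := mem_of_twist_mem hr ht hM hB1 hlap hβ (apply_mem_adjoin hu hqs hl hp hG) (l' w)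
    rwa [hpl'] at this
  obtain ⟨φ, hφ⟩ := exists_birMap (hp.comp l) hgen
  obtain ⟨κ, hκ0, hκ⟩ := exists_gradient (B := B) hr hdet
  refine ⟨φ, ?_, ?_⟩
  · refine isVolumePreserving_of_jacobian hl hl' (v := Y.ray) (part := P.part) (part' := P'.part)
      (fun i j h => hu.neg_one i j (by simpa [NefPartition.S] using h))
      (fun i j h => hu.zero i _ h j (by simp [NefPartition.S]))
      (fun i j h => hu'.neg_one i j (by simpa [NefPartition.S] using h))
      (fun i j h => hu'.zero i _ h j (by simp [NefPartition.S]))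
      hp hp' hG hG' hpl' (A := jacMat root M B κ) ?_
      (dlogMap_twist hp' hB hκ0 (dlogMap_gradient hp' hdet hB1 hlap hκ0 hκ))
      (jacMat_mulVec_gvec hr hB hM hlap hκ0 hκ) fun i => ?_
    · rw [det_jacMat hr hB hM hdet hlap hκ0 hκ]
      exact neg_one_pow_eq_or _ _
    · rw [coord, hφ, IsChar.eval_mono]
  · rw [hφ, eval_mirror hu hqs hl hp hG, hW, hW']

end main

end ToricLG

end

theorem corollary1 {n c : ℕ} {ι : Type*} [DecidableEq ι] [Fintype ι]
    (Y : ToricLG.SmoothCompleteFan n ι) (_hY : Y.IsFano)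
    (L : Fin c → Y.Pic) (_hL : ∀ i, Y.IsNef (L i))
    (_hΛ : Y.IsAmple (Y.antiK - ∑ i, L i)) :
    -- every amenable collection gives rise to a Laurent polynomial mirror in `n - c` variables
    (∀ (P : ToricLG.NefPartition Y L) (u : Fin c → ToricLG.DualLatt n) (s : Fin c → ι),
      P.IsAmenable u → (∀ i, s i ∈ P.S i.castSucc) →
        c ≤ n ∧ ∃ f : ToricLG.Laurent (n - c), ToricLG.IsLaurentMirror P u s f) ∧
    -- any two of these mirrors are mutation equivalent
    (∀ (P P' : ToricLG.NefPartition Y L) (u u' : Fin c → ToricLG.DualLatt n) (s s' : Fin c → ι)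
      (f f' : ToricLG.Laurent (n - c)),
      P.IsAmenable u → (∀ i, s i ∈ P.S i.castSucc) → ToricLG.IsLaurentMirror P u s f →
      P'.IsAmenable u' → (∀ i, s' i ∈ P'.S i.castSucc) → ToricLG.IsLaurentMirror P' u' s' f' →
        ToricLG.MutationEquivalent f f') := by
  refine ⟨fun P u s hu hs => ?_, fun P P' u u' s s' f f' hu hs hf hu' hs' hf' =>
    ToricLG.mutationEquivalent_of_isLaurentMirror hu hs hf hu' hs' hf'⟩
  obtain ⟨hcn, q, hq, hker⟩ := ToricLG.exists_quotient_coordinates hu hs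
  exact ⟨hcn, ToricLG.exists_isLaurentMirror hu hs hq hker⟩
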